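/- **Setting.** Let $d\ge 1$ and let $\Omega\subset\mathbb R^d$ be a polyhedral domain (open, connected) with a finite element mesh: $\Omega$ is the interior of the union of finitely many closed convex polytopes (the elements) with non-empty, pairwise disjoint interiors. Let $\tilde\Omega$ be the union of the open elements, $\mathbf n$ the outward unit normal on $\partial\Omega$, and $\partial_n=\mathbf n\cdot\nabla$. Let $\partial\Omega_D\subset\partial\Omega$ be measurable and $\partial\Omega_N=\partial\Omega\setminus\partial\Omega_D$. Let $\mathcal W^h$ be a finite-dimensional space of continuous functions on $\overline\Omega$ whose restriction to each closed element is the restriction of a $C^2$ function on $\mathbb R^d$ (for example, piecewise polynomials of degree $P$); derivatives are taken elementwise, and on $\partial\Omega$ they are the one-sided traces. Let $\mathbf a\in\mathbb R^d$ be a constant (hence divergence-free) velocity and $\kappa>0$ a constant diffusivity. The superscripts $+$ and $-$ on a part of $\partial\Omega$ denote its subsets where $\mathbf a\cdot\mathbf n\ge 0$ and $\mathbf a\cdot\mathbf n<0$. All inner products and norms are those of $L^2$ on the indicated sets (surface measure on the boundary): $(\cdot,\cdot)$ in the volume, $\langle\cdot,\cdot\rangle$ on the boundary. **Parameters.** Let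 $P\in\{1,2,3\}$, $c_s>0$, $\tau_{1,d}>0$ and $\tau_{1,a}\in(0,\infty]$ be constants ($\tau_{1,a}^{-1}=0$ if $\tau_{1,a}=\infty$; for instance $\tau_{1,a}=h/(2|\mathbf a|)$, $\tau_{1,d}=h^2/(12\kappa)$ and the shape factor $c_s=h|F|/|K|$ of elements $K$ with boundary faces $F$ and size $h$). Put, for $P=1,2,3$ respectively, $$\tau_{\rm eff}=\Big(\tau_{1,a}^{-2}+\tau_{1,d}^{-2}\Big)^{-1/2},\quad \Big(9\tau_{1,a}^{-2}+25\tau_{1,d}^{-2}\Big)^{-1/2},\quad \Big(25\tau_{1,a}^{-2}+\tfrac{1225}{9}\tau_{1,d}^{-2}\Big)^{-1/2},$$ $$\gamma_{\rm eff}=c_s\sqrt{\tfrac{\kappa}{3\tau_{1,d}\tau_{1,a}^{-2}+\frac13\tau_{1,d}^{-1}}},\quad c_s\sqrt{\tfrac{\kappa}{9\tau_{1,d}\tau_{1,a}^{-2}+4\tau_{1,d}^{-1}}},\quad c_s\sqrt{\tfrac{\kappa}{15\tau_{1,d}\tau_{1,a}^{-2}+15\tau_{1,d}^{-1}}},$$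 and $C_d=1,\ \tfrac15,\ \tfrac3{35}$, so that $\tau_{\rm eff}\le C_d\,\tau_{1,d}$. **Bilinear form.** For $w,\phi\in\mathcal W^h$ and $\beta\in\mathbb R$ let $B=B_A+B_D+B_{{\rm VMS},\tilde\Omega}+B_{{\rm VMS},\partial\Omega_D^+}$ with $$B_A(w,\phi)=-(\mathbf a\cdot\nabla w,\phi)_\Omega+\langle\mathbf a\cdot\mathbf n\,w,\phi\rangle_{\partial\Omega^+},$$ $$B_D(w,\phi)=(\kappa\nabla w,\nabla\phi)_\Omega-\langle\kappa w,\partial_n\phi\rangle_{\partial\Omega_D}-\langle\kappa\,\partial_nw,\phi\rangle_{\partial\Omega_D}+\langle\kappa\beta w,\phi\rangle_{\partial\Omega_D},$$ $$B_{{\rm VMS},\tilde\Omega}(w,\phi)=(\mathbf a\cdot\nabla w\,\tau_{\rm eff},\ \mathbf a\cdot\nabla\phi-\kappa\Delta\phi)_{\tilde\Omega},\qquad B_{{\rm VMS},\partial\Omega_D^+}(w,\phi)=\langle\mathbf a\cdot\nabla w\,\gamma_{\rm eff},\phi\rangle_{\partial\Omega_D^+}.$$ **Theorem.** Let $$T_1=\sup_{w\in\mathcal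 W^h}\frac{\|\partial_nw\|^2_{\partial\Omega_D}}{\|\nabla w\|^2_\Omega},\qquad T_2=\sup_{w\in\mathcal W^h}\frac{\|\mathbf a\cdot\nabla w\|^2_{\partial\Omega_D^+}}{\|\mathbf a\cdot\nabla w\|^2_\Omega},$$ and assume $$C_d\,\tau_{1,d}\le\inf_{w\in\mathcal W^h}\frac1{2\kappa}\frac{\|\nabla w\|^2_\Omega}{\|\Delta w\|^2_{\tilde\Omega}}\qquad\text{and}\qquad\beta\ge4\,(T_1+c_s^2\,T_2),$$ where each supremum and the infimum runs over those $w$ whose quotient has a non-zero denominator ($\sup\emptyset=0$, $\inf\emptyset=\infty$). Then: 1. For all $w\in\mathcal W^h$, $$B(w,w)\ \ge\ \tfrac14\tau_{\rm eff}\|\mathbf a\cdot\nabla w\|^2_\Omega+\tfrac12\big\|\sqrt{|\mathbf a\cdot\mathbf n|}\,w\big\|^2_{\partial\Omega}+\tfrac14\kappa\|\nabla w\|^2_\Omega+\tfrac14\beta\kappa\|w\|^2_{\partial\Omega_D}.$$ 2. If $\mathbf a\ne0$, or if $\beta>0$ and $\partial\Omega_D$ has positive surface measure, then for all $f\in L^2(\Omega)$,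 $g_N\in L^2(\partial\Omega_N)$, $\phi_D\in L^2(\partial\Omega_D)$ there is exactly one $\phi^h\in\mathcal W^h$ such that, for all $w\in\mathcal W^h$, $$B(w,\phi^h)=(w,f)_\Omega+\langle w,g_N\rangle_{\partial\Omega_N}-\langle\mathbf a\cdot\mathbf n\,w,\phi_D\rangle_{\partial\Omega_D^-}-\langle\kappa\,\partial_nw,\phi_D\rangle_{\partial\Omega_D}+\langle w,\kappa\beta\phi_D\rangle_{\partial\Omega_D}+(\mathbf a\cdot\nabla w\,\tau_{\rm eff},f)_\Omega+\langle\mathbf a\cdot\nabla w\,\gamma_{\rm eff},\phi_D\rangle_{\partial\Omega_D^+}.$$ -/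

import Mathlib

open MeasureTheory
open scoped ENNReal Topology

noncomputable section

namespace VMSNitsche

/-- The physical space `ℝ^d` with its Euclidean structure. -/
abbrev Space (d : ℕ) : Type := EuclideanSpace ℝ (Fin d)

variable {d : ℕ}

/-- Convex polytopes: bounded intersections of finitely many closed half-spaces. -/
def IsPolytope (K : Set (Space d)) : Prop :=
  Bornology.IsBounded K ∧
    ∃ s : Finset (Space d × ℝ), K = {x | ∀ p ∈ s, inner ℝ p.1 x ≤ p.2}

/-- A polytopal finite element mesh: finitely many closed elements, each a convex polytope with
non-empty interior, with pairwise disjoint interiors, that fill out a domain. Intervals,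
triangles, quadrilaterals, tetrahedra, hexahedra are all allowed as elements. -/
structure Mesh (d : ℕ) where
  /-- index set of the elements -/
  ι : Type
  [fintype_ι : Fintype ι]
  /-- the closed elements -/
  cell : ι → Set (Space d)
  polytope : ∀ i, IsPolytope (cell i)
  nonempty_interior : ∀ i, (interior (cell i)).Nonempty
  disjoint_interior : ∀ i j, i ≠ j → Disjoint (interior (cell i)) (interior (cell j))
  /-- the meshed region `Ω` is a domain -/
  connected : IsConnected (interior (⋃ i, cell i))

/-- `n` is the outward unit normal of `Ω` at the point `x`, in a flat part of the boundary:
near `x`, the set `Ω` is the open half-space on the inner side of the hyperplane through `x`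
orthogonal to `n`. -/
def IsOutwardNormal (Ω : Set (Space d)) (x n : Space d) : Prop :=
  ‖n‖ = 1 ∧ ∀ᶠ y in 𝓝 x, (y ∈ Ω ↔ inner ℝ n (y - x) < 0)

open Classical in
/-- The outward unit normal field of `Ω`. For a polyhedral domain it exists at all boundary points
outside a set of zero surface measure (edges, corners), where the value is set to `0`. -/
def normal (Ω : Set (Space d)) (x : Space d) : Space d :=
  if h : ∃ n, IsOutwardNormal Ω x n then h.choose else 0

/-- Surface measure: the `(d-1)`-dimensional Hausdorff measure, normalised so that it agrees with
Lebesgue measure on hyperplanes (and is the counting measure for `d = 1`). -/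
def surface (d : ℕ) : Measure (Space d) := Measure.euclideanHausdorffMeasure (d - 1)

namespace Mesh

variable (M : Mesh d)

instance : Fintype M.ι := M.fintype_ι

/-- The domain `Ω`. -/
def domain : Set (Space d) := interior (⋃ i, M.cell i)

/-- The union of the open elements. -/
def openCells : Set (Space d) := ⋃ i, interior (M.cell i)

/-- The boundary `∂Ω`. -/
def boundary : Set (Space d) := frontier M.domain

/-- The normal component `a ⬝ n` of a vector `a` on the boundary. -/
def normalComp (a x : Space d) : ℝ := inner ℝ a (normal M.domain x)

/-- The outflow part `Γ⁺` of a piece `Γ` of the boundary. -/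
def outflow (a : Space d) (Γ : Set (Space d)) : Set (Space d) := {x ∈ Γ | 0 ≤ M.normalComp a x}

/-- The inflow part `Γ⁻` of a piece `Γ` of the boundary. -/
def inflow (a : Space d) (Γ : Set (Space d)) : Set (Space d) := {x ∈ Γ | M.normalComp a x < 0}

/-- The gradient of a function on the closure of `Ω`. It is the classical gradient in the open
elements; at boundary points it is the one-sided gradient (the trace of the elementwise
gradient). -/
def grad (w : Space d → ℝ) (x : Space d) : Space d := gradientWithin w (closure M.domain) x

/-- The normal derivative on the boundary. -/
def normalDeriv (w : Space d → ℝ) (x : Space d) : ℝ :=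
  inner ℝ (normal M.domain x) (M.grad w x)

end Mesh

/-- A finite element space on the mesh: a finite-dimensional space of real functions on the
closure of `Ω` that, on every closed element, coincide with a `C²` function (for instance a
polynomial). Since the elements are closed and finite in number and the functions are
single-valued on shared faces, they are continuous on the closure of `Ω`. Functions on the closure
of `Ω` are represented by their extension by zero. -/
structure IsFESpace (M : Mesh d) (W : Submodule ℝ (Space d → ℝ)) : Prop where
  finiteDimensional : FiniteDimensional ℝ W
  piecewise : ∀ w ∈ W, ∀ i, ∃ v : Space d → ℝ, ContDiff ℝ 2 v ∧ Set.EqOn w v (M.cell i)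
  extended_by_zero : ∀ w ∈ W, ∀ x ∉ closure M.domain, w x = 0

/-- Squared `L²` norm of a scalar function on a set of positive volume. -/
def volSq (S : Set (Space d)) (f : Space d → ℝ) : ℝ := ∫ x in S, f x ^ 2

/-- Squared `L²` norm of a scalar function on a part of the boundary. -/
def surfSq (Γ : Set (Space d)) (f : Space d → ℝ) : ℝ := ∫ x in Γ, f x ^ 2 ∂(surface d)

/-- Squared `L²(Ω)` norm of the gradient. -/
def gradSq (M : Mesh d) (w : Space d → ℝ) : ℝ := ∫ x in M.domain, ‖M.grad w x‖ ^ 2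

/-! ### Model parameters -/

/-- Polynomial degree `P = 1, 2, 3`. -/
inductive Degree
  | linear
  | quadratic
  | cubic

/-- The effective volumetric stabilization parameter. The advective limit `τ₁a` may be `∞`,
which is the value of `h / (2|a|)` for `a = 0`. -/
def tauEff (P : Degree) (τ₁a : ℝ≥0∞) (τ₁d : ℝ) : ℝ :=
  match P with
  | .linear => √(1 / ((τ₁a⁻¹).toReal ^ 2 + τ₁d⁻¹ ^ 2))
  | .quadratic => √(1 / (9 * (τ₁a⁻¹).toReal ^ 2 + 25 * τ₁d⁻¹ ^ 2))
  | .cubic => √(1 / (25 * (τ₁a⁻¹).toReal ^ 2 + 1225 / 9 * τ₁d⁻¹ ^ 2))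

/-- The effective boundary stabilization parameter. -/
def gammaEff (P : Degree) (cs κ : ℝ) (τ₁a : ℝ≥0∞) (τ₁d : ℝ) : ℝ :=
  match P with
  | .linear => cs * √(κ / (3 * τ₁d * (τ₁a⁻¹).toReal ^ 2 + 1 / 3 * τ₁d⁻¹))
  | .quadratic => cs * √(κ / (9 * τ₁d * (τ₁a⁻¹).toReal ^ 2 + 4 * τ₁d⁻¹))
  | .cubic => cs * √(κ / (15 * τ₁d * (τ₁a⁻¹).toReal ^ 2 + 15 * τ₁d⁻¹))

/-- The constant `C_d` with `τ_eff ≤ C_d τ₁d`. -/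
def Cd : Degree → ℝ
  | .linear => 1
  | .quadratic => 1 / 5
  | .cubic => 3 / 35

/-! ### Inverse-estimate constants

The suprema and the infimum run over those discrete functions for which the quotient is defined,
with values in `[0, ∞]`; the infimum over the empty set is `∞`. -/

/-- `sup ‖∂ₙw‖²_{∂Ω_D} / ‖∇w‖²_Ω` -/
def T₁ (M : Mesh d) (ΓD : Set (Space d)) (W : Submodule ℝ (Space d → ℝ)) : ℝ≥0∞ :=
  ⨆ (w) (_ : w ∈ W) (_ : gradSq M w ≠ 0),
    ENNReal.ofReal (surfSq ΓD (M.normalDeriv w) / gradSq M w)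

/-- `sup ‖a ⬝ ∇w‖²_{∂Ω_D⁺} / ‖a ⬝ ∇w‖²_Ω` -/
def T₂ (M : Mesh d) (ΓD : Set (Space d)) (a : Space d) (W : Submodule ℝ (Space d → ℝ)) : ℝ≥0∞ :=
  ⨆ (w) (_ : w ∈ W) (_ : volSq M.domain (fun x => inner ℝ a (M.grad w x)) ≠ 0),
    ENNReal.ofReal (surfSq (M.outflow a ΓD) (fun x => inner ℝ a (M.grad w x)) /
      volSq M.domain (fun x => inner ℝ a (M.grad w x)))

/-- `inf (1 / (2κ)) ‖∇w‖²_Ω / ‖Δw‖²`, the last norm over the union of the open elements. -/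
def tauBound (M : Mesh d) (κ : ℝ) (W : Submodule ℝ (Space d → ℝ)) : ℝ≥0∞ :=
  ⨅ (w : Space d → ℝ) (_ : w ∈ W) (_ : volSq M.openCells (Laplacian.laplacian w) ≠ 0),
    ENNReal.ofReal (1 / (2 * κ) * (gradSq M w / volSq M.openCells (Laplacian.laplacian w)))

/-! ### The discrete formulation -/

/-- Advective part. -/
def BA (M : Mesh d) (a : Space d) (w φ : Space d → ℝ) : ℝ :=
  -(∫ x in M.domain, inner ℝ a (M.grad w x) * φ x)
    + ∫ x in M.outflow a M.boundary, M.normalComp a x * w x * φ x ∂(surface d)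

/-- Diffusive part with Nitsche's boundary terms. -/
def BD (M : Mesh d) (ΓD : Set (Space d)) (κ β : ℝ) (w φ : Space d → ℝ) : ℝ :=
  (∫ x in M.domain, κ * inner ℝ (M.grad w x) (M.grad φ x))
    - (∫ x in ΓD, κ * w x * M.normalDeriv φ x ∂(surface d))
    - (∫ x in ΓD, κ * M.normalDeriv w x * φ x ∂(surface d))
    + ∫ x in ΓD, κ * β * w x * φ x ∂(surface d)

/-- Volumetric variational multiscale part, over the union of the open elements. -/
def BVMSvol (M : Mesh d) (a : Space d) (κ τ : ℝ) (w φ : Space d → ℝ) : ℝ :=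
  ∫ x in M.openCells,
    inner ℝ a (M.grad w x) * τ * (inner ℝ a (M.grad φ x) - κ * Laplacian.laplacian φ x)

/-- Boundary variational multiscale part, over the outflow Dirichlet boundary. -/
def BVMSbdy (M : Mesh d) (ΓD : Set (Space d)) (a : Space d) (γ : ℝ) (w φ : Space d → ℝ) : ℝ :=
  ∫ x in M.outflow a ΓD, inner ℝ a (M.grad w x) * γ * φ x ∂(surface d)

/-- The full bilinear form. -/
def B (M : Mesh d) (ΓD : Set (Space d)) (a : Space d) (κ β τ γ : ℝ) (w φ : Space d → ℝ) : ℝ :=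
  BA M a w φ + BD M ΓD κ β w φ + BVMSvol M a κ τ w φ + BVMSbdy M ΓD a γ w φ

/-- The right-hand side functional, with source `f`, Neumann (or Robin) data `gN` on the complement
of `ΓD` in the boundary, and Dirichlet data `φD` on `ΓD`. -/
def rhs (M : Mesh d) (ΓD : Set (Space d)) (a : Space d) (κ β τ γ : ℝ)
    (f gN φD : Space d → ℝ) (w : Space d → ℝ) : ℝ :=
  (∫ x in M.domain, w x * f x)
    + (∫ x in M.boundary \ ΓD, w x * gN x ∂(surface d))
    - (∫ x in M.inflow a ΓD, M.normalComp a x * w x * φD x ∂(surface d))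
    - (∫ x in ΓD, κ * M.normalDeriv w x * φD x ∂(surface d))
    + (∫ x in ΓD, w x * (κ * β) * φD x ∂(surface d))
    + (∫ x in M.domain, inner ℝ a (M.grad w x) * τ * f x)
    + ∫ x in M.outflow a ΓD, inner ℝ a (M.grad w x) * γ * φD x ∂(surface d)

end VMSNitsche

end

open VMSNitsche

/-! Coercivity rests on an exact identity for the advective energy and on three weighted Young
inequalities. The volume integral of `(a·∇w) w` is half the boundary integral of `(a·n) w²`, by the
divergence theorem for the continuous piecewise `C²` function `w²`. Adding the outflow term leaves
half of `|a·n| w²` on all of the boundary (`BA_self`). The remaining indefinite terms are the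
Nitsche consistency terms, the Laplacian term of the stabilization and its boundary term.
Cauchy–Schwarz, the trace constants `T₁`, `T₂`, the inverse estimate for the Laplacian and `γ² ≤ 3
cs² κ τ` (`gammaEff_sq_le`) bound them so that a quarter of the advective, diffusive and penalty
terms survives (`coercivity_algebra`, `coercive`).

Unique solvability follows because `B` is then definite. Zero energy forces a zero gradient, hence a
constant on the connected domain. The constant vanishes, either because a non-zero constant field
cannot have zero flux density almost everywhere on the boundary, or because the penalty controls a
set of positive surface measure (`eq_zero_of_norms_eq_zero`). In finite dimension a definite form
represents every functional (`existsUnique_of_definite`).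

Most of the work is the divergence theorem for Hausdorff surface measure. On one polytope,
integration by parts is performed against a product of smooth cutoffs, one per face; the derivative
of each cutoff is a thin layer that converges to the surface integral over that facet
(`tendsto_layer`, `integral_polyhedron_fderiv`). Summing over elements, the facet normals cancel
inside the domain and give its normal on the boundary (`sum_facetNormal`), up to the null set
`edges`. Away from it, boundary points are regular, that is, they lie in exactly one element; there
the one-sided gradient is the classical gradient of the local `C²` piece. -/

noncomputable section

namespace VMSNitsche

variable {d : ℕ}

/-! ### Surface measure on hyperplanes -/

/-- Coordinates adapted to a unit vector `n`: a position along `n` and a point of the orthogonal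
hyperplane. -/
theorem exists_hyperplane_coords (hd : 1 ≤ d) {n : Space d} (hn : ‖n‖ = 1) :
    ∃ ι : Space (d - 1) →ₗᵢ[ℝ] Space d, (∀ y, inner ℝ n (ι y) = 0) ∧
      (∀ x, inner ℝ n x = 0 → x ∈ Set.range ι) ∧
      MeasurePreserving (fun z : ℝ × Space (d - 1) => z.1 • n + ι z.2)
        (volume.prod volume) volume := by
  obtain ⟨k, rfl⟩ : ∃ k, d = k + 1 := ⟨d - 1, by omega⟩
  change ∃ ι : Space k →ₗᵢ[ℝ] Space (k + 1), (∀ y, inner ℝ n (ι y) = 0) ∧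
    (∀ x, inner ℝ n x = 0 → x ∈ Set.range ι) ∧
      MeasurePreserving (fun z : ℝ × Space k => z.1 • n + ι z.2) (volume.prod volume) volume
  obtain ⟨b, hb⟩ := Orthonormal.exists_orthonormalBasis_extension_of_card_eq (𝕜 := ℝ)
    (E := Space (k + 1)) (ι := Fin (k + 1)) (by simp) (v := fun _ => n) (s := {0}) (by
      constructor
      · intro i; simpa using hn
      · intro i j hij; exact absurd (Subsingleton.elim i j) hij)
  have hb0 : b 0 = n := hb 0 (by simp)
  have horth : Orthonormal ℝ (fun j : Fin k => b j.succ) :=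
    b.orthonormal.comp _ (Fin.succ_injective k)
  let L : Space k →ₗ[ℝ] Space (k + 1) :=
    { toFun := fun y => ∑ j, y j • b j.succ
      map_add' := fun y z => by simp [add_smul, Finset.sum_add_distrib]
      map_smul' := fun c y => by simp [Finset.smul_sum, smul_smul] }
  have hL : ∀ y, L y = ∑ j, y j • b j.succ := fun y => rfl
  let ι : Space k →ₗᵢ[ℝ] Space (k + 1) :=
    { L with
      norm_map' := fun y => by
        have h1 : ‖L y‖ ^ 2 = ‖y‖ ^ 2 := by
          rw [← real_inner_self_eq_norm_sq, hL, horth.inner_sum, EuclideanSpace.norm_sq_eq]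
          simp [sq]
        exact (sq_eq_sq₀ (norm_nonneg _) (norm_nonneg _)).1 h1 }
  have hι : ∀ y, ι y = ∑ j, y j • b j.succ := fun y => rfl
  have hinner : ∀ y, inner ℝ n (ι y) = 0 := by
    intro y
    rw [hι, inner_sum]
    refine Finset.sum_eq_zero fun j _ => ?_
    rw [inner_smul_right, ← hb0, b.orthonormal.2 (Fin.succ_ne_zero j).symm, mul_zero]
  refine ⟨ι, hinner, ?_, ?_⟩
  · intro x hx
    refine ⟨WithLp.toLp 2 fun j => inner ℝ (b j.succ) x, ?_⟩
    rw [hι]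
    conv_rhs => rw [← b.sum_repr' x, Fin.sum_univ_succ, hb0, hx, zero_smul, zero_add]
  · have h1 := (volume_preserving_piFinSuccAbove (fun _ : Fin (k + 1) => ℝ) 0).symm
    have h2 := PiLp.volume_preserving_toLp (Fin (k + 1))
    have h3 := b.measurePreserving_repr_symm
    have h4 := (MeasurePreserving.id (volume : Measure ℝ)).prod
      (PiLp.volume_preserving_ofLp (Fin k))
    have h5 := h3.comp (h2.comp (h1.comp h4))
    convert h5 using 1
    ext1 z
    simp only [Function.comp, Prod.map]
    rw [← hb0, hι]
    rw [← b.sum_repr (b.repr.symm _)]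
    rw [Fin.sum_univ_succ]
    simp [MeasurableEquiv.piFinSuccAbove]

/-- Isometries preserve Hausdorff measure, and in `ℝ^(d-1)` the normalised `(d-1)`-dimensional one
is Lebesgue measure. All later computations with `surface` on flat pieces go through this chart. -/
theorem surface_restrict_hyperplane {n : Space d} (hn : ‖n‖ = 1) (c : ℝ)
    {ι : Space (d - 1) →ₗᵢ[ℝ] Space d} (h0 : ∀ y, inner ℝ n (ι y) = 0)
    (h1 : ∀ x, inner ℝ n x = 0 → x ∈ Set.range ι) :
    (surface d).restrict {x | inner ℝ n x = c} = Measure.map (fun y => c • n + ι y) volume := by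
  have hiso : Isometry (fun y => c • n + ι y) :=
    (IsometryEquiv.addLeft (c • n)).isometry.comp ι.isometry
  have hr : Set.range (fun y => c • n + ι y) = {x | inner ℝ n x = c} := by
    have hnn : inner ℝ n n = (1 : ℝ) := by rw [real_inner_self_eq_norm_sq, hn, one_pow]
    ext x
    constructor
    · rintro ⟨y, rfl⟩
      simp [inner_add_right, inner_smul_right, h0, hn]
    · intro hx
      obtain ⟨y, hy⟩ := h1 (x - c • n) (by
        rw [inner_sub_right, inner_smul_right, hnn]; simpa using sub_eq_zero.2 hx)
      exact ⟨y, by simp [hy]⟩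
  rw [surface, ← hr, ← hiso.map_euclideanHausdorffMeasure,
    EuclideanSpace.euclideanHausdorffMeasure_eq_volume]

/-- Two different hyperplanes meet in a set of zero surface measure. -/
theorem surface_inter_hyperplane (hd : 1 ≤ d) {p q : Space d × ℝ} (hp : ‖p.1‖ = 1)
    (hpq : ∃ z, inner ℝ p.1 z = p.2 ∧ inner ℝ q.1 z ≠ q.2) :
    surface d ({x | inner ℝ p.1 x = p.2} ∩ {x | inner ℝ q.1 x = q.2}) = 0 := by
  obtain ⟨ι, h0, h1, -⟩ := exists_hyperplane_coords hd hp
  have hm : ∀ q : Space d × ℝ, MeasurableSet {x : Space d | inner ℝ q.1 x = q.2} := fun q =>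
    (isClosed_eq (by fun_prop) continuous_const).measurableSet
  rw [Set.inter_comm, ← Measure.restrict_apply (hm q), surface_restrict_hyperplane hp p.2 h0 h1,
    Measure.map_apply (by fun_prop) (hm q)]
  obtain ⟨z, hz, hzq⟩ := hpq
  have hnn : inner ℝ p.1 p.1 = (1 : ℝ) := by rw [real_inner_self_eq_norm_sq, hp, one_pow]
  obtain ⟨y, hy⟩ := h1 (z - p.2 • p.1) (by
    rw [inner_sub_right, inner_smul_right, hnn, hz]; simp)
  let A : AffineSubspace ℝ (Space (d - 1)) :=
    { carrier := (fun y => p.2 • p.1 + ι y) ⁻¹' {x | inner ℝ q.1 x = q.2}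
      smul_vsub_vadd_mem' := by
        intro c u v w hu hv hw
        simp only [Set.mem_preimage, Set.mem_ofPred_eq, inner_add_right, vsub_eq_sub, vadd_eq_add,
          map_add, map_smul, map_sub, inner_smul_right, inner_sub_right] at hu hv hw ⊢
        linear_combination hw + c * (hu - hv) }
  refine Measure.addHaar_affineSubspace volume A fun hA => hzq ?_
  have : y ∈ (A : Set (Space (d - 1))) := by rw [hA]; trivial
  have h : inner ℝ q.1 (p.2 • p.1 + ι y) = q.2 := this
  rwa [hy, add_sub_cancel] at h

/-! ### Half-space descriptions of polytopes -/

/-- The closed polyhedron described by a finite family of half-spaces. -/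
def polyhedron (s : Finset (Space d × ℝ)) : Set (Space d) := {x | ∀ p ∈ s, inner ℝ p.1 x ≤ p.2}

/-- The points at which all constraints are strict. -/
def openPolyhedron (s : Finset (Space d × ℝ)) : Set (Space d) :=
  {x | ∀ p ∈ s, inner ℝ p.1 x < p.2}

/-- The part of the polyhedron where exactly the constraint `p` is active. -/
def facet (s : Finset (Space d × ℝ)) (p : Space d × ℝ) : Set (Space d) :=
  {x | inner ℝ p.1 x = p.2 ∧ ∀ q ∈ s, q ≠ p → inner ℝ q.1 x < q.2}

/-- Unit normals, and different constraints have different bounding hyperplanes. -/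
def IsReduced (s : Finset (Space d × ℝ)) : Prop :=
  (∀ p ∈ s, ‖p.1‖ = 1) ∧
    ∀ p ∈ s, ∀ q ∈ s, p ≠ q → ∃ z, inner ℝ p.1 z = p.2 ∧ inner ℝ q.1 z ≠ q.2

theorem isClosed_polyhedron (s : Finset (Space d × ℝ)) : IsClosed (polyhedron s) := by
  have : polyhedron s = ⋂ p ∈ s, {x | inner ℝ p.1 x ≤ p.2} := by ext; simp [polyhedron]
  rw [this]
  exact isClosed_biInter fun p _ => isClosed_le (by fun_prop) continuous_const

theorem isOpen_openPolyhedron (s : Finset (Space d × ℝ)) : IsOpen (openPolyhedron s) := by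
  have : openPolyhedron s = ⋂ p ∈ s, {x | inner ℝ p.1 x < p.2} := by ext; simp [openPolyhedron]
  rw [this]
  exact isOpen_biInter_finset fun p _ => isOpen_lt (by fun_prop) continuous_const

theorem convex_polyhedron (s : Finset (Space d × ℝ)) : Convex ℝ (polyhedron s) := by
  have : polyhedron s = ⋂ p ∈ s, {x | inner ℝ p.1 x ≤ p.2} := by ext; simp [polyhedron]
  rw [this]
  exact convex_iInter₂ fun p _ => convex_halfSpace_le
    (innerSL ℝ p.1 : Space d →L[ℝ] ℝ).toLinearMap.isLinear _

theorem openPolyhedron_subset (s : Finset (Space d × ℝ)) : openPolyhedron s ⊆ polyhedron s :=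
  fun _ hx p hp => (hx p hp).le

theorem facet_subset {s : Finset (Space d × ℝ)} {p : Space d × ℝ} : facet s p ⊆ polyhedron s := by
  intro x hx q hq
  by_cases h : q = p
  · subst h; exact hx.1.le
  · exact (hx.2 q hq h).le

theorem measurableSet_facet (s : Finset (Space d × ℝ)) (p : Space d × ℝ) :
    MeasurableSet (facet s p) := by
  have : facet s p = {x | inner ℝ p.1 x = p.2} ∩ ⋂ q ∈ s, {x | q ≠ p → inner ℝ q.1 x < q.2} := by
    ext; simp [facet]
  rw [this]
  refine (isClosed_eq (by fun_prop) continuous_const).measurableSet.inter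
    (Finset.measurableSet_biInter _ fun q _ => ?_)
  by_cases h : q = p
  · simp [h]
  · simpa [h] using (isOpen_lt (f := fun x : Space d => (inner ℝ q.1 x : ℝ)) (g := fun _ => q.2)
      (by fun_prop) continuous_const).measurableSet

/-- Moving along the normal changes the constraint value at unit speed. -/
theorem inner_add_smul_normal {n : Space d} (hn : ‖n‖ = 1) (x : Space d) (t : ℝ) :
    inner ℝ n (x + t • n) = inner ℝ n x + t := by
  rw [inner_add_right, inner_smul_right, real_inner_self_eq_norm_sq, hn]; ring

theorem tendsto_add_smul (x v : Space d) : Filter.Tendsto (fun t : ℝ => x + t • v) (𝓝 0) (𝓝 x) := by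
  have : Continuous fun t : ℝ => x + t • v := by fun_prop
  simpa using this.tendsto 0

theorem interior_polyhedron {s : Finset (Space d × ℝ)} (hs : ∀ p ∈ s, ‖p.1‖ = 1) :
    interior (polyhedron s) = openPolyhedron s := by
  refine Set.Subset.antisymm (fun x hx p hp => ?_)
    (interior_maximal (openPolyhedron_subset s) (isOpen_openPolyhedron s))
  have h := (tendsto_add_smul x p.1).eventually (mem_interior_iff_mem_nhds.1 hx)
  obtain ⟨t, ht, ht0⟩ := ((h.filter_mono nhdsWithin_le_nhds).and
    (self_mem_nhdsWithin : Set.Ioi (0 : ℝ) ∈ 𝓝[>] 0)).exists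
  have := ht p hp
  rw [inner_add_smul_normal (hs p hp)] at this
  have h0 : (0 : ℝ) < t := ht0
  linarith

/-- Every polytope with interior points has a reduced description. -/
theorem exists_reduced {K : Set (Space d)} (hK : ∃ s : Finset (Space d × ℝ), K = polyhedron s)
    (hne : (interior K).Nonempty) :
    ∃ s : Finset (Space d × ℝ), IsReduced s ∧ K = polyhedron s := by
  classical
  obtain ⟨s, rfl⟩ := hK
  let f : Space d × ℝ → Space d × ℝ := fun p => (‖p.1‖⁻¹ • p.1, ‖p.1‖⁻¹ * p.2)
  let s' := (s.filter fun p => p.1 ≠ 0).image f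
  have hs1 : ∀ p ∈ s', ‖p.1‖ = 1 := by
    intro p hp
    simp only [s', Finset.mem_image, Finset.mem_filter] at hp
    obtain ⟨q, ⟨-, hq⟩, rfl⟩ := hp
    simp [f, norm_smul, hq]
  have heq : polyhedron s = polyhedron s' := by
    ext x
    simp only [polyhedron, s', Set.mem_ofPred_eq, Finset.forall_mem_image, Finset.mem_filter]
    have key : ∀ p : Space d × ℝ, p.1 ≠ 0 →
        (inner ℝ (f p).1 x ≤ (f p).2 ↔ inner ℝ p.1 x ≤ p.2) := by
      intro p hp
      have : 0 < ‖p.1‖⁻¹ := by positivity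
      simp only [f, inner_smul_left, conj_trivial]
      exact mul_le_mul_iff_right₀ this
    constructor
    · intro h p hp
      exact (key p hp.2).2 (h p hp.1)
    · intro h p hp
      -- A constraint with zero normal reads `0 ≤ p.2`; it may be discarded because the polyhedron
      -- is non-empty.
      by_cases hp0 : p.1 = 0
      · obtain ⟨z, hz⟩ := hne
        have := interior_subset hz p hp
        simpa [hp0] using this
      · exact (key p hp0).1 (h ⟨hp, hp0⟩)
  refine ⟨s', ⟨hs1, fun p hp q hq hpq => ?_⟩, heq⟩
  by_contra! hcon
  have hpn : inner ℝ p.1 p.1 = (1 : ℝ) := by rw [real_inner_self_eq_norm_sq, hs1 p hp, one_pow]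
  have hqn : inner ℝ q.1 q.1 = (1 : ℝ) := by rw [real_inner_self_eq_norm_sq, hs1 q hq, one_pow]
  have h0 : p.2 * inner ℝ q.1 p.1 = q.2 := by
    have := hcon (p.2 • p.1) (by rw [inner_smul_right, hpn, mul_one])
    rwa [inner_smul_right] at this
  have hlin : ∀ v, inner ℝ p.1 v = 0 → inner ℝ q.1 v = (0 : ℝ) := by
    intro v hv
    have := hcon (p.2 • p.1 + v) (by rw [inner_add_right, inner_smul_right, hpn, hv]; ring)
    rw [inner_add_right, inner_smul_right, h0] at this
    linarith
  set c : ℝ := inner ℝ q.1 p.1 with hc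
  have hcc : c * c = 1 := by
    have := hlin (q.1 - c • p.1) (by
      rw [inner_sub_right, inner_smul_right, hpn, real_inner_comm, ← hc]; ring)
    rw [inner_sub_right, inner_smul_right, hqn, ← hc] at this
    linarith
  have hqp : q.1 = c • p.1 := by
    rw [← sub_eq_zero, ← inner_self_eq_zero (𝕜 := ℝ)]
    rw [inner_sub_left, inner_sub_right, inner_sub_right, inner_smul_left, inner_smul_left,
      inner_smul_right, inner_smul_right, hpn, hqn, real_inner_comm q.1 p.1, ← hc, conj_trivial]
    linarith
  -- Two constraints on the same hyperplane have normals equal up to the sign `c`. For `c = 1` they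
  -- coincide; for `c = -1` they are opposite half-spaces, which leaves no interior.
  rcases mul_self_eq_one_iff.1 hcc with h | h
  · exact hpq (Prod.ext (by rw [hqp, h, one_smul]) (by rw [← h0, h, mul_one]))
  · obtain ⟨z, hz⟩ := hne
    rw [heq, interior_polyhedron hs1] at hz
    have h1 := hz p hp
    have h2 := hz q hq
    rw [hqp, ← h0, h, inner_smul_left, conj_trivial] at h2
    linarith

theorem polyhedron_diff_null (hd : 1 ≤ d) {s : Finset (Space d × ℝ)} (hs : IsReduced s) :
    surface d (⋃ p ∈ s, ⋃ q ∈ s, ⋃ (_ : p ≠ q),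
      {x | inner ℝ p.1 x = p.2} ∩ {x | inner ℝ q.1 x = q.2}) = 0 := by
  refine (measure_biUnion_null_iff s.countable_toSet).2 fun p hp =>
    (measure_biUnion_null_iff s.countable_toSet).2 fun q hq => measure_iUnion_null fun hpq => ?_
  exact surface_inter_hyperplane hd (hs.1 p hp) (hs.2 p hp q hq hpq)

/-! ### Smooth cutoffs -/

open Real (smoothTransition)

theorem contDiff_smoothTransition : ContDiff ℝ 1 smoothTransition :=
  smoothTransition.contDiff (n := 1)

theorem continuous_deriv_smoothTransition : Continuous (deriv smoothTransition) :=
  contDiff_smoothTransition.continuous_deriv le_rfl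

theorem deriv_smoothTransition_eq_zero {t : ℝ} (ht : t ∉ Set.Icc (0 : ℝ) 1) :
    deriv smoothTransition t = 0 := by
  rw [Set.mem_Icc, not_and_or, not_le, not_le] at ht
  rcases ht with ht | ht
  · have : smoothTransition =ᶠ[𝓝 t] fun _ => 0 := by
      filter_upwards [Iio_mem_nhds ht] with x hx
      exact smoothTransition.zero_of_nonpos (le_of_lt hx)
    rw [this.deriv_eq, deriv_const]
  · have : smoothTransition =ᶠ[𝓝 t] fun _ => 1 := by
      filter_upwards [Ioi_mem_nhds ht] with x hx
      exact smoothTransition.one_of_one_le (le_of_lt hx)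
    rw [this.deriv_eq, deriv_const]

/-- The unit mass across a layer is what gives the limiting surface integral the coefficient one. -/
theorem integral_deriv_smoothTransition : ∫ t, deriv smoothTransition t = 1 := by
  have h1 : ∫ t in Set.Icc (0 : ℝ) 1, deriv smoothTransition t = ∫ t, deriv smoothTransition t :=
    setIntegral_eq_integral_of_forall_compl_eq_zero fun t ht => deriv_smoothTransition_eq_zero ht
  rw [← h1, integral_Icc_eq_integral_Ioc, ← intervalIntegral.integral_of_le zero_le_one,
    intervalIntegral.integral_deriv_eq_sub
      (fun x _ => (contDiff_smoothTransition.differentiable one_ne_zero) x)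
      (continuous_deriv_smoothTransition.intervalIntegrable _ _)]
  simp

/-- The cutoff for a family of half-spaces, with a transition layer of width `ε`. -/
def cutoff (s : Finset (Space d × ℝ)) (ε : ℝ) (x : Space d) : ℝ :=
  ∏ p ∈ s, smoothTransition ((p.2 - inner ℝ p.1 x) / ε)

theorem contDiff_cutoff (s : Finset (Space d × ℝ)) (ε : ℝ) : ContDiff ℝ 1 (cutoff s ε) := by
  unfold cutoff
  refine contDiff_prod fun p _ => contDiff_smoothTransition.comp ?_
  have : ContDiff ℝ 1 fun x : Space d => (inner ℝ p.1 x : ℝ) := (innerSL ℝ p.1).contDiff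
  exact (contDiff_const.sub this).div_const ε

theorem cutoff_nonneg (s : Finset (Space d × ℝ)) (ε : ℝ) (x : Space d) : 0 ≤ cutoff s ε x :=
  Finset.prod_nonneg fun _ _ => smoothTransition.nonneg _

theorem cutoff_le_one (s : Finset (Space d × ℝ)) (ε : ℝ) (x : Space d) : cutoff s ε x ≤ 1 :=
  Finset.prod_le_one (fun _ _ => smoothTransition.nonneg _) fun _ _ => smoothTransition.le_one _

theorem cutoff_eq_zero {s : Finset (Space d × ℝ)} {ε : ℝ} (hε : 0 < ε) {x : Space d}
    (hx : ¬ ∀ p ∈ s, inner ℝ p.1 x ≤ p.2) : cutoff s ε x = 0 := by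
  push Not at hx
  obtain ⟨p, hp, hpx⟩ := hx
  exact Finset.prod_eq_zero hp
    (smoothTransition.zero_of_nonpos (div_nonpos_of_nonpos_of_nonneg (by linarith) hε.le))

/-- Limit of the cutoffs along points converging to a point off the bounding hyperplanes. -/
theorem tendsto_cutoff {s : Finset (Space d × ℝ)} {x : Space d}
    (hx : ∀ p ∈ s, inner ℝ p.1 x ≠ p.2) {u : ℝ → Space d}
    (hu : Filter.Tendsto u (𝓝[>] 0) (𝓝 x)) :
    Filter.Tendsto (fun ε => cutoff s ε (u ε)) (𝓝[>] 0)
      (𝓝 ((openPolyhedron s).indicator (fun _ => 1) x)) := by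
  have hcont : ∀ p : Space d × ℝ, Filter.Tendsto (fun ε => p.2 - inner ℝ p.1 (u ε)) (𝓝[>] 0)
      (𝓝 (p.2 - inner ℝ p.1 x)) := fun p => tendsto_const_nhds.sub (tendsto_const_nhds.inner hu)
  have hid : Filter.Tendsto (fun ε : ℝ => ε) (𝓝[>] 0) (𝓝 0) :=
    Filter.tendsto_id.mono_left nhdsWithin_le_nhds
  refine Filter.Tendsto.congr' ?_ tendsto_const_nhds
  by_cases hmem : x ∈ openPolyhedron s
  · have : ∀ᶠ ε in 𝓝[>] (0 : ℝ), ∀ p ∈ s, ε ≤ p.2 - inner ℝ p.1 (u ε) := by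
      rw [Filter.eventually_all_finset]
      intro p hp
      filter_upwards [hid.eventually_lt (hcont p) (by linarith [hmem p hp])] with ε h using h.le
    filter_upwards [this, self_mem_nhdsWithin] with ε h hε
    rw [Set.indicator_of_mem hmem, cutoff, Finset.prod_eq_one]
    exact fun p hp => smoothTransition.one_of_one_le ((one_le_div hε).2 (h p hp))
  · rw [Set.indicator_of_notMem hmem]
    obtain ⟨p, hp, hpx⟩ : ∃ p ∈ s, p.2 < inner ℝ p.1 x := by
      by_contra! h
      exact hmem fun p hp => lt_of_le_of_ne (h p hp) (hx p hp)
    filter_upwards [(hcont p).eventually_lt_const (sub_neg.2 hpx), self_mem_nhdsWithin]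
      with ε h hε
    rw [cutoff_eq_zero hε]
    push Not
    exact ⟨p, hp, by linarith⟩

-- The product rule gives one term per constraint: a layer of height of order `1 / ε` along its
-- hyperplane, cut off by the remaining constraints. The minus sign comes from the outward
-- orientation of `p.1`.
open Classical in
theorem fderiv_cutoff (s : Finset (Space d × ℝ)) (ε : ℝ) (x a : Space d) :
    fderiv ℝ (cutoff s ε) x a = -∑ p ∈ s, inner ℝ a p.1 *
      (cutoff (s.erase p) ε x * (deriv smoothTransition ((p.2 - inner ℝ p.1 x) / ε) / ε)) := by
  have h1 : ∀ p : Space d × ℝ, HasFDerivAt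
      (fun x : Space d => smoothTransition ((p.2 - inner ℝ p.1 x) / ε))
      (deriv smoothTransition ((p.2 - inner ℝ p.1 x) / ε) • (ε⁻¹ • (-(innerSL ℝ p.1)))) x := by
    intro p
    refine HasDerivAt.comp_hasFDerivAt x
      ((contDiff_smoothTransition.differentiable one_ne_zero) _).hasDerivAt ?_
    have := (((innerSL ℝ p.1 : Space d →L[ℝ] ℝ).hasFDerivAt (x := x)).const_sub p.2).const_smul ε⁻¹
    refine this.congr_of_eventuallyEq (Filter.Eventually.of_forall fun y => ?_)
    simp [div_eq_inv_mul]
  have h2 := HasFDerivAt.finsetProd (u := s) fun p _ => h1 p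
  have h3 : fderiv ℝ (cutoff s ε) x = _ := h2.fderiv
  rw [h3]
  simp only [FunLike.coe_sum, Finset.sum_apply, smul_apply,
    neg_apply, innerSL_apply_apply, smul_eq_mul, ← Finset.sum_neg_distrib]
  refine Finset.sum_congr rfl fun p _ => ?_
  rw [cutoff, real_inner_comm a p.1]
  ring

/-! ### The divergence theorem on a polytope -/

open Real (smoothTransition)

/-- A layer of width `ε` along a hyperplane: change of variables. -/
theorem integral_layer {E : Type*} [MeasurableSpace E] (μ : Measure E) [SFinite μ]
    (c : ℝ) {ε : ℝ} (hε : 0 < ε) (g : ℝ × E → ℝ) (hg : Integrable g (volume.prod μ))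
    (hg' : Integrable (fun z : ℝ × E => g (c - ε * z.1, z.2)) (volume.prod μ)) :
    ∫ z, g z ∂(volume.prod μ) = ∫ z : ℝ × E, ε * g (c - ε * z.1, z.2) ∂(volume.prod μ) := by
  rw [integral_prod_symm _ hg, integral_const_mul, integral_prod_symm _ hg', ← integral_const_mul]
  congr 1
  ext y
  have h1 := Measure.integral_comp_mul_left (fun t => g (c - t, y)) ε
  rw [integral_sub_left_eq_self (fun t => g (t, y)) volume c] at h1
  simp only at h1 ⊢
  rw [h1, abs_of_pos (by positivity), smul_eq_mul, ← mul_assoc, mul_inv_cancel₀ hε.ne', one_mul]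

theorem exists_bound_polyhedron {s : Finset (Space d × ℝ)}
    (hb : Bornology.IsBounded (polyhedron s)) {v : Space d → ℝ} (hv : Continuous v) :
    ∃ C R : ℝ, 0 ≤ C ∧ ∀ x ∈ polyhedron s, |v x| ≤ C ∧ ‖x‖ ≤ R := by
  have hc : IsCompact (polyhedron s) := Metric.isCompact_of_isClosed_isBounded
    (isClosed_polyhedron s) hb
  obtain ⟨C, hC⟩ := hc.exists_bound_of_continuousOn hv.continuousOn
  obtain ⟨R, hR⟩ := hb.exists_norm_le
  exact ⟨max C 0, R, le_max_right _ _, fun x hx => ⟨(hC x hx).trans (le_max_left _ _), hR x hx⟩⟩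

-- The derivative of the transition is supported where the constraint `p` holds, and the other
-- factors vanish where another constraint fails, so each layer lives inside the polyhedron. This
-- provides compact support and uniform bounds.
open Classical in
theorem layer_eq_zero {s : Finset (Space d × ℝ)} {p : Space d × ℝ} {ε : ℝ} (hε : 0 < ε)
    {x : Space d} (hx : x ∉ polyhedron s) :
    cutoff (s.erase p) ε x * (deriv smoothTransition ((p.2 - inner ℝ p.1 x) / ε) / ε) = 0 := by
  by_cases h : ∀ q ∈ s.erase p, inner ℝ q.1 x ≤ q.2
  · rw [deriv_smoothTransition_eq_zero, zero_div, mul_zero]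
    intro hmem
    refine hx fun q hq => ?_
    by_cases hqp : q = p
    · subst hqp
      have := (le_div_iff₀ hε).1 hmem.1
      linarith
    · exact h q (Finset.mem_erase.2 ⟨hqp, hq⟩)
  · rw [cutoff_eq_zero hε h, zero_mul]

open Classical in
/-- Averages over thin layers along a facet converge to the surface integral over the facet. -/
theorem tendsto_layer (hd : 1 ≤ d) {s : Finset (Space d × ℝ)} (hs : IsReduced s)
    (hb : Bornology.IsBounded (polyhedron s)) {p : Space d × ℝ} (hp : p ∈ s)
    {v : Space d → ℝ} (hv : Continuous v) :
    Filter.Tendsto (fun ε => ∫ x, v x * (cutoff (s.erase p) ε x *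
        (deriv smoothTransition ((p.2 - inner ℝ p.1 x) / ε) / ε))) (𝓝[>] 0)
      (𝓝 (∫ x in facet s p, v x ∂(surface d))) := by
  obtain ⟨ι, h0, h1, hmp⟩ := exists_hyperplane_coords hd (hs.1 p hp)
  have hn := hs.1 p hp
  obtain ⟨C, R, hC0, hCR⟩ := exists_bound_polyhedron hb hv
  obtain ⟨D, hD⟩ := (isCompact_Icc (a := (0 : ℝ)) (b := 1)).exists_bound_of_continuousOn
    continuous_deriv_smoothTransition.continuousOn
  have hpinner : ∀ (t : ℝ) y, inner ℝ p.1 (t • p.1 + ι y) = t := by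
    intro t y
    rw [inner_add_right, inner_smul_right, h0, real_inner_self_eq_norm_sq, hn]; ring
  set F : ℝ → Space d → ℝ := fun ε x => v x * (cutoff (s.erase p) ε x *
        (deriv smoothTransition ((p.2 - inner ℝ p.1 x) / ε) / ε)) with hF
  have hFc : ∀ ε, Continuous (F ε) := fun ε => hv.mul (((contDiff_cutoff _ ε).continuous).mul
    ((continuous_deriv_smoothTransition.comp (by fun_prop)).div_const ε))
  -- Stretched coordinates: `z.1` is the depth below the hyperplane in units of `ε`, `z.2` the
  -- tangential position. The Jacobian `ε` cancels the factor `1 / ε` of the layer, so one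
  -- integrable bound serves all `ε`.
  set H : ℝ → ℝ × Space (d - 1) → ℝ := fun ε z =>
    ε * F ε ((p.2 - ε * z.1) • p.1 + ι z.2) with hH
  have hHc : ∀ ε, Continuous (H ε) := fun ε => continuous_const.mul ((hFc ε).comp (by fun_prop))
  have hHeq : ∀ ε, 0 < ε → ∀ z, H ε z = v ((p.2 - ε * z.1) • p.1 + ι z.2) *
      cutoff (s.erase p) ε ((p.2 - ε * z.1) • p.1 + ι z.2) * deriv smoothTransition z.1 := by
    intro ε hε z
    simp only [hH, hF, hpinner]
    rw [show (p.2 - (p.2 - ε * z.1)) / ε = z.1 by field_simp; ring]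
    field_simp
  set bd : ℝ × Space (d - 1) → ℝ :=
    (Set.Icc (0 : ℝ) 1 ×ˢ Metric.closedBall 0 R).indicator fun _ => C * D with hbd
  have hbdi : Integrable bd (volume.prod volume) := by
    refine (integrable_indicator_iff ?_).2 (integrableOn_const ?_)
    · exact measurableSet_Icc.prod measurableSet_closedBall
    · rw [Measure.prod_prod]
      exact ENNReal.mul_ne_top (by simp) (measure_closedBall_lt_top).ne
  have hbound : ∀ ε, 0 < ε → ∀ z, ‖H ε z‖ ≤ bd z := by
    intro ε hε z
    set x := (p.2 - ε * z.1) • p.1 + ι z.2 with hx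
    by_cases hxK : x ∈ polyhedron s
    · by_cases hz1 : z.1 ∈ Set.Icc (0 : ℝ) 1
      · have hz2 : z.2 ∈ Metric.closedBall (0 : Space (d - 1)) R := by
          rw [mem_closedBall_zero_iff, ← ι.norm_map]
          refine le_trans ?_ (hCR x hxK).2
          have : ‖x‖ ^ 2 = (p.2 - ε * z.1) ^ 2 + ‖ι z.2‖ ^ 2 := by
            rw [hx, norm_add_sq_real, inner_smul_left, h0, norm_smul, hn]
            simp
          refine (sq_le_sq₀ (norm_nonneg _) (norm_nonneg _)).1 ?_
          rw [this]; nlinarith [sq_nonneg (p.2 - ε * z.1)]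
        rw [hbd, Set.indicator_of_mem (Set.mem_prod.2 ⟨hz1, hz2⟩), hHeq ε hε, norm_mul, norm_mul]
        refine mul_le_mul ?_ (hD _ hz1) (norm_nonneg _) hC0
        refine le_trans (mul_le_of_le_one_right (norm_nonneg _) ?_) (hCR x hxK).1
        rw [Real.norm_of_nonneg (cutoff_nonneg _ _ _)]
        exact cutoff_le_one _ _ _
      · rw [hHeq ε hε, deriv_smoothTransition_eq_zero hz1, mul_zero, norm_zero]
        exact Set.indicator_nonneg (fun _ _ => mul_nonneg hC0
          ((norm_nonneg _).trans (hD 0 (by simp)))) _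
    · simp only [hH, hF]
      rw [layer_eq_zero hε hxK, mul_zero, mul_zero, norm_zero]
      exact Set.indicator_nonneg (fun _ _ => mul_nonneg hC0
          ((norm_nonneg _).trans (hD 0 (by simp)))) _
  have hHi : ∀ ε, 0 < ε → Integrable (H ε) (volume.prod volume) := fun ε hε =>
    hbdi.mono' (hHc ε).aestronglyMeasurable (Filter.Eventually.of_forall (hbound ε hε))
  have hFi : ∀ ε, 0 < ε → Integrable (F ε) := by
    intro ε hε
    refine (hFc ε).integrable_of_hasCompactSupport ?_
    refine HasCompactSupport.intro
      (Metric.isCompact_of_isClosed_isBounded (isClosed_polyhedron s) hb) fun x hx => ?_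
    simp only [hF]
    rw [layer_eq_zero hε hx, mul_zero]
  have hchange : ∀ ε, 0 < ε → ∫ x, F ε x = ∫ z, H ε z ∂(volume.prod volume) := by
    intro ε hε
    rw [← hmp.map_eq, integral_map hmp.measurable.aemeasurable
      (hFc ε).aestronglyMeasurable]
    refine (integral_layer volume p.2 hε (fun z : ℝ × Space (d - 1) => F ε (z.1 • p.1 + ι z.2))
      (hmp.integrable_comp_of_integrable (hFi ε hε)) ?_)
    have := (hHi ε hε).const_mul ε⁻¹
    refine this.congr (Filter.Eventually.of_forall fun z => ?_)
    simp only [hH]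
    field_simp
  set G : Space (d - 1) → ℝ := fun y => (openPolyhedron (s.erase p)).indicator (fun _ => 1)
    (p.2 • p.1 + ι y) * v (p.2 • p.1 + ι y) with hG
  have hlim : Filter.Tendsto (fun ε => ∫ z, H ε z ∂(volume.prod volume)) (𝓝[>] 0)
      (𝓝 (∫ z : ℝ × Space (d - 1), deriv smoothTransition z.1 * G z.2 ∂(volume.prod volume))) := by
    refine tendsto_integral_filter_of_dominated_convergence bd
      (Filter.Eventually.of_forall fun ε => (hHc ε).aestronglyMeasurable) ?_ hbdi ?_
    · filter_upwards [self_mem_nhdsWithin] with ε hε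
      exact Filter.Eventually.of_forall (hbound ε hε)
    -- The cutoffs of the other constraints have a known limit only off their own hyperplanes;
    -- reducedness makes the traces of these on the hyperplane of `p` null sets.
    · have hnull : ∀ᵐ y : Space (d - 1), ∀ q ∈ s.erase p,
          inner ℝ q.1 (p.2 • p.1 + ι y) ≠ q.2 := by
        refine (ae_ball_iff (s.erase p).countable_toSet).2 fun q hq => ?_
        have hq' := Finset.mem_erase.1 hq
        have := surface_inter_hyperplane hd hn (hs.2 p hp q hq'.2 hq'.1.symm)
        have hm : MeasurableSet {x : Space d | inner ℝ q.1 x = q.2} :=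
          (isClosed_eq (by fun_prop) continuous_const).measurableSet
        rw [Set.inter_comm, ← Measure.restrict_apply hm, surface_restrict_hyperplane hn p.2 h0 h1,
          Measure.map_apply (by fun_prop) hm] at this
        rw [ae_iff]
        simpa using this
      have hnull2 : ∀ᵐ z : ℝ × Space (d - 1) ∂(volume.prod volume), ∀ q ∈ s.erase p,
          inner ℝ q.1 (p.2 • p.1 + ι z.2) ≠ q.2 :=
        Measure.quasiMeasurePreserving_snd.ae hnull
      filter_upwards [hnull2] with z hz
      have hu : Filter.Tendsto (fun ε : ℝ => (p.2 - ε * z.1) • p.1 + ι z.2) (𝓝[>] 0)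
          (𝓝 (p.2 • p.1 + ι z.2)) := by
        have : Continuous fun ε : ℝ => (p.2 - ε * z.1) • p.1 + ι z.2 := by fun_prop
        simpa using (this.tendsto 0).mono_left (nhdsWithin_le_nhds (s := Set.Ioi 0))
      have h3 := (((hv.tendsto _).comp hu).mul (tendsto_cutoff hz hu)).mul_const
        (deriv smoothTransition z.1)
      rw [show deriv smoothTransition z.1 * G z.2 = v (p.2 • p.1 + ι z.2) *
        (openPolyhedron (s.erase p)).indicator (fun _ => 1) (p.2 • p.1 + ι z.2) *
          deriv smoothTransition z.1 by simp only [hG]; ring]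
      refine h3.congr' ?_
      filter_upwards [self_mem_nhdsWithin] with ε hε
      rw [hHeq ε hε]
      rfl
  rw [integral_prod_mul, integral_deriv_smoothTransition, one_mul] at hlim
  have hGint : ∫ y, G y = ∫ x in facet s p, v x ∂(surface d) := by
    have hset : facet s p = openPolyhedron (s.erase p) ∩ {x | inner ℝ p.1 x = p.2} := by
      ext x
      simp only [facet, openPolyhedron, Finset.mem_erase, Set.mem_inter_iff, Set.mem_ofPred_eq]
      tauto
    have hm := (isOpen_openPolyhedron (s.erase p)).measurableSet
    rw [hset, ← Measure.restrict_restrict hm,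
      surface_restrict_hyperplane hn p.2 h0 h1, ← integral_indicator hm, integral_map (by fun_prop)
        (hv.measurable.indicator hm).aestronglyMeasurable]
    congr 1
    ext y
    by_cases hy : p.2 • p.1 + ι y ∈ openPolyhedron (s.erase p)
    · simp [hG, hy]
    · simp [hG, hy]
  rw [← hGint]
  refine hlim.congr' ?_
  filter_upwards [self_mem_nhdsWithin] with ε hε
  exact (hchange ε hε).symm

/-- **Divergence theorem** on a polytope, for a constant vector field times a scalar function. -/
theorem integral_polyhedron_fderiv (hd : 1 ≤ d) {s : Finset (Space d × ℝ)} (hs : IsReduced s)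
    (hb : Bornology.IsBounded (polyhedron s)) {v : Space d → ℝ} (hv : ContDiff ℝ 1 v)
    (a : Space d) :
    ∫ x in openPolyhedron s, fderiv ℝ v x a =
      ∑ p ∈ s, inner ℝ a p.1 * ∫ x in facet s p, v x ∂(surface d) := by
  classical
  have hK := Metric.isCompact_of_isClosed_isBounded (isClosed_polyhedron s) hb
  have hdv : Continuous fun x => fderiv ℝ v x a :=
    (hv.continuous_fderiv one_ne_zero).clm_apply continuous_const
  obtain ⟨C, R, hC0, hCR⟩ := exists_bound_polyhedron hb hdv
  have hparts : ∀ ε, 0 < ε → ∫ x, cutoff s ε x * fderiv ℝ v x a =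
      ∑ p ∈ s, inner ℝ a p.1 * ∫ x, v x * (cutoff (s.erase p) ε x *
        (deriv smoothTransition ((p.2 - inner ℝ p.1 x) / ε) / ε)) := by
    intro ε hε
    have hint : ∀ {g : Space d → ℝ}, Continuous g → (∀ x ∉ polyhedron s, g x = 0) →
        Integrable g := fun hg h0 =>
      hg.integrable_of_hasCompactSupport (HasCompactSupport.intro hK h0)
    have hlayer : ∀ p ∈ s, Integrable fun x => v x * (cutoff (s.erase p) ε x *
        (deriv smoothTransition ((p.2 - inner ℝ p.1 x) / ε) / ε)) := fun p _ =>
      hint (hv.continuous.mul (((contDiff_cutoff _ ε).continuous).mul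
        ((continuous_deriv_smoothTransition.comp (by fun_prop)).div_const ε)))
        fun x hx => by rw [layer_eq_zero hε hx, mul_zero]
    have hfd : ∀ x, fderiv ℝ (cutoff s ε) x a * v x = -∑ p ∈ s, inner ℝ a p.1 *
        (v x * (cutoff (s.erase p) ε x *
        (deriv smoothTransition ((p.2 - inner ℝ p.1 x) / ε) / ε))) := by
      intro x
      rw [fderiv_cutoff, neg_mul, Finset.sum_mul]
      congr 1
      exact Finset.sum_congr rfl fun p _ => by ring
    have hc0 : ∀ x ∉ polyhedron s, cutoff s ε x = 0 := fun x hx => cutoff_eq_zero hε hx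
    -- The cutoff vanishes outside the bounded polyhedron, so integration by parts over the whole
    -- space has no boundary term.
    rw [integral_mul_fderiv_eq_neg_fderiv_mul_of_integrable]
    · simp_rw [hfd]
      rw [integral_neg, neg_neg, integral_finsetSum _ fun p hp => (hlayer p hp).const_mul _]
      exact Finset.sum_congr rfl fun p _ => integral_const_mul _ _
    · simp_rw [hfd]
      exact (integrable_finsetSum _ fun p hp => (hlayer p hp).const_mul _).neg
    · exact hint ((contDiff_cutoff s ε).continuous.mul hdv) fun x hx => by rw [hc0 x hx, zero_mul]
    · exact hint ((contDiff_cutoff s ε).continuous.mul hv.continuous)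
        fun x hx => by rw [hc0 x hx, zero_mul]
    · exact fun x _ => (contDiff_cutoff s ε).differentiable one_ne_zero x
    · exact fun x _ => hv.differentiable one_ne_zero x
  have hlim1 : Filter.Tendsto (fun ε => ∫ x, cutoff s ε x * fderiv ℝ v x a) (𝓝[>] 0)
      (𝓝 (∑ p ∈ s, inner ℝ a p.1 * ∫ x in facet s p, v x ∂(surface d))) := by
    refine (tendsto_finsetSum s fun p hp =>
      (tendsto_layer hd hs hb hp hv.continuous).const_mul (inner ℝ a p.1)).congr' ?_
    filter_upwards [self_mem_nhdsWithin] with ε hε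
    exact (hparts ε hε).symm
  have hlim2 : Filter.Tendsto (fun ε => ∫ x, cutoff s ε x * fderiv ℝ v x a) (𝓝[>] 0)
      (𝓝 (∫ x, (openPolyhedron s).indicator (fun _ => 1) x * fderiv ℝ v x a)) := by
    refine tendsto_integral_filter_of_dominated_convergence
      ((polyhedron s).indicator fun _ => C) (Filter.Eventually.of_forall fun ε =>
        ((contDiff_cutoff s ε).continuous.mul hdv).aestronglyMeasurable) ?_ ?_ ?_
    · filter_upwards [self_mem_nhdsWithin] with ε hε
      refine Filter.Eventually.of_forall fun x => ?_
      by_cases hx : x ∈ polyhedron s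
      · rw [Set.indicator_of_mem hx, norm_mul, Real.norm_of_nonneg (cutoff_nonneg _ _ _)]
        exact (mul_le_of_le_one_left (norm_nonneg _) (cutoff_le_one _ _ _)).trans (hCR x hx).1
      · rw [Set.indicator_of_notMem hx, cutoff_eq_zero hε hx, zero_mul, norm_zero]
    · exact (integrable_indicator_iff hK.measurableSet).2 (integrableOn_const hK.measure_lt_top.ne)
    · have hnull : ∀ᵐ x : Space d, ∀ p ∈ s, inner ℝ p.1 x ≠ p.2 := by
        refine (ae_ball_iff s.countable_toSet).2 fun p hp => ?_
        rw [ae_iff]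
        have hne : p.1 ≠ 0 := fun h => by simpa [h] using hs.1 p hp
        let A : AffineSubspace ℝ (Space d) :=
          { carrier := {x | inner ℝ p.1 x = p.2}
            smul_vsub_vadd_mem' := by
              intro c u v w hu hv hw
              simp only [Set.mem_ofPred_eq, inner_add_right, vsub_eq_sub, vadd_eq_add,
                inner_smul_right, inner_sub_right] at hu hv hw ⊢
              linear_combination hw + c * (hu - hv) }
        have hA : A ≠ ⊤ := by
          intro hA
          have h1 : ((p.2 + 1) • p.1 : Space d) ∈ (A : Set (Space d)) := by rw [hA]; trivial
          have h2 : inner ℝ p.1 ((p.2 + 1) • p.1) = p.2 := h1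
          rw [inner_smul_right, real_inner_self_eq_norm_sq, hs.1 p hp] at h2
          linarith
        exact measure_mono_null (fun x hx => not_not.1 hx)
          (Measure.addHaar_affineSubspace volume A hA)
      filter_upwards [hnull] with x hx
      exact (tendsto_cutoff hx tendsto_const_nhds).mul_const _
  have hkey := tendsto_nhds_unique hlim2 hlim1
  rw [← hkey, ← integral_indicator (isOpen_openPolyhedron s).measurableSet]
  congr 1
  ext x
  by_cases hx : x ∈ openPolyhedron s <;> simp [hx]

/-! ### Facets: finite measure, uniqueness and local shape -/

theorem facet_measure_lt_top (hd : 1 ≤ d) {s : Finset (Space d × ℝ)} (hs : IsReduced s)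
    (hb : Bornology.IsBounded (polyhedron s)) {p : Space d × ℝ} (hp : p ∈ s) :
    surface d (facet s p) < ∞ := by
  obtain ⟨ι, h0, h1, -⟩ := exists_hyperplane_coords hd (hs.1 p hp)
  have hn := hs.1 p hp
  obtain ⟨R, hR⟩ := hb.exists_norm_le
  have hsub : facet s p = facet s p ∩ {x | inner ℝ p.1 x = p.2} := by
    ext x; simp only [facet, Set.mem_inter_iff, Set.mem_ofPred_eq]; tauto
  rw [hsub, ← Measure.restrict_apply (measurableSet_facet s p),
    surface_restrict_hyperplane hn p.2 h0 h1,
    Measure.map_apply (by fun_prop) (measurableSet_facet s p)]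
  refine (measure_mono fun y hy => ?_).trans_lt (measure_closedBall_lt_top (x := 0) (r := R + |p.2|))
  rw [mem_closedBall_zero_iff, ← ι.norm_map]
  have h2 : ‖p.2 • p.1 + ι y‖ ≤ R := hR _ (facet_subset hy)
  have h3 := norm_sub_le (p.2 • p.1 + ι y) (p.2 • p.1)
  rw [add_sub_cancel_left, norm_smul, hn, mul_one, Real.norm_eq_abs] at h3
  linarith

theorem facet_unique {s : Finset (Space d × ℝ)} {p q : Space d × ℝ} {x : Space d} (hq : q ∈ s)
    (hxp : x ∈ facet s p) (hxq : x ∈ facet s q) : p = q := by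
  by_contra h
  exact (hxp.2 q hq (Ne.symm h)).ne hxq.1

/-- Near a point of a facet, the polyhedron is a half-space. -/
theorem eventually_mem_polyhedron_iff {s : Finset (Space d × ℝ)} {p : Space d × ℝ} (hp : p ∈ s)
    {x : Space d} (hx : x ∈ facet s p) :
    ∀ᶠ y in 𝓝 x, (y ∈ polyhedron s ↔ inner ℝ p.1 y ≤ p.2) := by
  have h : ∀ᶠ y in 𝓝 x, ∀ q ∈ s, q ≠ p → inner ℝ q.1 y < q.2 := by
    rw [Filter.eventually_all_finset]
    intro q hq
    by_cases hqp : q = p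
    · simp [hqp]
    · have hc : Continuous fun y : Space d => (inner ℝ q.1 y : ℝ) := by fun_prop
      filter_upwards [hc.continuousAt.eventually_lt_const (hx.2 q hq hqp)] with y hy _ using hy
  filter_upwards [h] with y hy
  refine ⟨fun h => h p hp, fun hle q hq => ?_⟩
  by_cases hqp : q = p
  · rw [hqp]; exact hle
  · exact (hy q hq hqp).le

/-! ### Outward normals -/

/-- If two unit normals `n ≠ m` existed, the direction `m - n` would have negative product with `n`
and positive product with `m`; a short step along it would lie inside `Ω` by one description and
outside by the other. -/
theorem IsOutwardNormal.unique {Ω : Set (Space d)} {x n m : Space d} (hn : IsOutwardNormal Ω x n)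
    (hm : IsOutwardNormal Ω x m) : n = m := by
  by_contra hne
  have h1 : inner ℝ n m < (1 : ℝ) := inner_lt_one_iff_real_of_norm_eq_one hn.1 hm.1 |>.2 hne
  have h2 := (tendsto_add_smul x (m - n)).eventually (hn.2.and hm.2)
  obtain ⟨t, ⟨ha, hb⟩, ht0⟩ := ((h2.filter_mono nhdsWithin_le_nhds).and
    (self_mem_nhdsWithin : Set.Ioi (0 : ℝ) ∈ 𝓝[>] 0)).exists
  have ht : (0 : ℝ) < t := ht0
  have h3 := ha.symm.trans hb
  rw [add_sub_cancel_left, inner_smul_right, inner_smul_right, inner_sub_right, inner_sub_right,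
    real_inner_self_eq_norm_sq, real_inner_self_eq_norm_sq, hn.1, hm.1, real_inner_comm n m] at h3
  have h4 : t * (inner ℝ n m - 1 ^ 2) < 0 := mul_neg_of_pos_of_neg ht (by linarith)
  have h5 := h3.1 h4
  nlinarith

theorem IsOutwardNormal.normal_eq {Ω : Set (Space d)} {x n : Space d}
    (hn : IsOutwardNormal Ω x n) : normal Ω x = n := by
  have h : ∃ n, IsOutwardNormal Ω x n := ⟨n, hn⟩
  rw [normal, dif_pos h]
  exact h.choose_spec.unique hn

theorem norm_normal_le (Ω : Set (Space d)) (x : Space d) : ‖normal Ω x‖ ≤ 1 := by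
  rw [normal]
  split_ifs with h
  · exact h.choose_spec.1.le
  · simp

/-! ### Local structure of a mesh -/

namespace Mesh

variable (M : Mesh d)

/-- A reduced half-space description of an element. -/
def faces (i : M.ι) : Finset (Space d × ℝ) :=
  (exists_reduced (M.polytope i).2 (M.nonempty_interior i)).choose

theorem isReduced_faces (i : M.ι) : IsReduced (M.faces i) :=
  (exists_reduced (M.polytope i).2 (M.nonempty_interior i)).choose_spec.1

theorem cell_eq (i : M.ι) : M.cell i = polyhedron (M.faces i) :=
  (exists_reduced (M.polytope i).2 (M.nonempty_interior i)).choose_spec.2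

theorem isBounded_faces (i : M.ι) : Bornology.IsBounded (polyhedron (M.faces i)) :=
  M.cell_eq i ▸ (M.polytope i).1

theorem interior_cell (i : M.ι) : interior (M.cell i) = openPolyhedron (M.faces i) := by
  rw [M.cell_eq, interior_polyhedron (M.isReduced_faces i).1]

theorem isClosed_cell (i : M.ι) : IsClosed (M.cell i) := M.cell_eq i ▸ isClosed_polyhedron _

theorem convex_cell (i : M.ι) : Convex ℝ (M.cell i) := M.cell_eq i ▸ convex_polyhedron _

theorem isCompact_cell (i : M.ι) : IsCompact (M.cell i) :=
  Metric.isCompact_of_isClosed_isBounded (M.isClosed_cell i) (M.polytope i).1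

theorem closure_interior_cell (i : M.ι) : closure (interior (M.cell i)) = M.cell i := by
  rw [(M.convex_cell i).closure_interior_eq_closure_of_nonempty_interior (M.nonempty_interior i),
    (M.isClosed_cell i).closure_eq]

theorem isOpen_domain : IsOpen M.domain := isOpen_interior

theorem isOpen_openCells : IsOpen M.openCells := isOpen_iUnion fun _ => isOpen_interior

theorem interior_cell_subset_domain (i : M.ι) : interior (M.cell i) ⊆ M.domain :=
  interior_mono (Set.subset_iUnion _ i)

theorem closure_domain : closure M.domain = ⋃ i, M.cell i := by
  have hc : IsClosed (⋃ i, M.cell i) := isClosed_iUnion_of_finite M.isClosed_cell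
  refine Set.Subset.antisymm (closure_minimal interior_subset hc) (Set.iUnion_subset fun i => ?_)
  rw [← M.closure_interior_cell i]
  exact closure_mono (M.interior_cell_subset_domain i)

theorem openCells_subset_domain : M.openCells ⊆ M.domain :=
  Set.iUnion_subset M.interior_cell_subset_domain

theorem boundary_subset : M.boundary ⊆ ⋃ i, M.cell i := by
  rw [← M.closure_domain]; exact frontier_subset_closure

theorem isClosed_boundary : IsClosed M.boundary := isClosed_frontier

/-- What the open elements miss lies in the frontiers of the elements, which are null because the
elements are convex. -/
theorem domain_ae_eq_openCells : M.openCells =ᵐ[volume] M.domain := by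
  refine Filter.EventuallyLE.antisymm M.openCells_subset_domain.eventuallyLE ?_
  rw [ae_le_set]
  refine measure_mono_null (t := ⋃ i, frontier (M.cell i)) ?_
    (measure_iUnion_null fun i => (M.convex_cell i).addHaar_frontier volume)
  rintro x ⟨hx, hxo⟩
  obtain ⟨i, hi⟩ := Set.mem_iUnion.1 (interior_subset hx)
  exact Set.mem_iUnion.2 ⟨i, subset_closure hi, fun h => hxo (Set.mem_iUnion.2 ⟨i, h⟩)⟩

theorem disjoint_interior_cell {i j : M.ι} (hij : i ≠ j) : Disjoint (interior (M.cell i)) (M.cell j) := by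
  rw [← M.closure_interior_cell j]
  exact (M.disjoint_interior i j hij).closure_right isOpen_interior

/-- The points where two different bounding hyperplanes of an element meet: a superset of the
faces of codimension at least two. -/
def edges : Set (Space d) := ⋃ i, ⋃ p ∈ M.faces i, ⋃ q ∈ M.faces i, ⋃ (_ : p ≠ q),
  {x | inner ℝ p.1 x = p.2} ∩ {x | inner ℝ q.1 x = q.2}

theorem surface_edges (hd : 1 ≤ d) : surface d M.edges = 0 :=
  measure_iUnion_null fun i => polyhedron_diff_null hd (M.isReduced_faces i)

variable {M}

theorem mem_facet_of_mem_cell {x : Space d} (hx : x ∉ M.edges) {i : M.ι} (hi : x ∈ M.cell i)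
    (hi' : x ∉ interior (M.cell i)) : ∃ p ∈ M.faces i, x ∈ facet (M.faces i) p := by
  rw [M.cell_eq] at hi
  rw [M.interior_cell] at hi'
  obtain ⟨p, hp, hpx⟩ : ∃ p ∈ M.faces i, p.2 ≤ inner ℝ p.1 x := by
    by_contra! h
    exact hi' h
  have hpe := le_antisymm (hi p hp) hpx
  refine ⟨p, hp, hpe, fun q hq hqp => lt_of_le_of_ne (hi q hq) fun hqe => hx ?_⟩
  simp only [edges, Set.mem_iUnion]
  exact ⟨i, p, hp, q, hq, hqp.symm, hpe, hqe⟩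

theorem facet_subset_cell {i : M.ι} {p : Space d × ℝ} : facet (M.faces i) p ⊆ M.cell i := by
  rw [M.cell_eq]; exact facet_subset

theorem facet_not_interior {i : M.ι} {p : Space d × ℝ} (hp : p ∈ M.faces i) {x : Space d}
    (hx : x ∈ facet (M.faces i) p) : x ∉ interior (M.cell i) := by
  rw [M.interior_cell]
  exact fun h => (h p hp).ne hx.1

/-- Two elements that share a point of a facet lie on opposite sides. -/
theorem normal_eq_neg {i j : M.ι} (hij : i ≠ j) {p q : Space d × ℝ} (hp : p ∈ M.faces i)
    (hq : q ∈ M.faces j) {x : Space d} (hxp : x ∈ facet (M.faces i) p)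
    (hxq : x ∈ facet (M.faces j) q) : q.1 = -p.1 := by
  have hpn := (M.isReduced_faces i).1 p hp
  have hqn := (M.isReduced_faces j).1 q hq
  by_contra hne
  have hlt : -1 < inner ℝ p.1 q.1 := by
    have h : inner ℝ p.1 (-q.1) < (1 : ℝ) :=
      (inner_lt_one_iff_real_of_norm_eq_one hpn (by rwa [norm_neg])).2
        fun h => hne (by rw [h, neg_neg])
    rw [inner_neg_right] at h
    linarith
  -- For non-opposite unit normals this direction points strictly into both half-spaces, so a short
  -- step enters both interiors, which are disjoint.
  set m := -(p.1 + q.1) with hm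
  have h1 : inner ℝ p.1 m < 0 := by
    rw [hm, inner_neg_right, inner_add_right, real_inner_self_eq_norm_sq, hpn]; linarith
  have h2 : inner ℝ q.1 m < 0 := by
    rw [hm, inner_neg_right, inner_add_right, real_inner_self_eq_norm_sq, hqn,
      real_inner_comm]; linarith
  have hin : ∀ {k : M.ι} {r : Space d × ℝ}, r ∈ M.faces k → x ∈ facet (M.faces k) r →
      inner ℝ r.1 m < 0 → ∀ᶠ t in 𝓝[>] (0 : ℝ), x + t • m ∈ interior (M.cell k) := by
    intro k r hr hxr hrm
    have h := (tendsto_add_smul x m).eventually (eventually_mem_polyhedron_iff hr hxr).eventually_nhds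
    filter_upwards [h.filter_mono nhdsWithin_le_nhds, self_mem_nhdsWithin] with t ht ht0
    have ht0' : (0 : ℝ) < t := ht0
    rw [M.cell_eq, mem_interior_iff_mem_nhds]
    have hlt : inner ℝ r.1 (x + t • m) < r.2 := by
      rw [inner_add_right, inner_smul_right, hxr.1]
      nlinarith
    have hc : Continuous fun y : Space d => (inner ℝ r.1 y : ℝ) := by fun_prop
    filter_upwards [ht, hc.continuousAt.eventually_lt_const hlt] with y hy hy2
    exact hy.2 hy2.le
  obtain ⟨t, hti, htj⟩ := ((hin hp hxp h1).and (hin hq hxq h2)).exists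
  exact Set.disjoint_left.1 (M.disjoint_interior i j hij) hti htj

/-- A point that belongs to exactly one element. -/
def IsRegular (i : M.ι) (x : Space d) : Prop := ∀ j, x ∈ M.cell j ↔ j = i

theorem isRegular_of_mem_interior {i : M.ι} {x : Space d} (hx : x ∈ interior (M.cell i)) :
    IsRegular i x := by
  refine fun j => ⟨fun hj => ?_, fun h => h ▸ interior_subset hx⟩
  by_contra hji
  exact Set.disjoint_left.1 (M.disjoint_interior_cell (Ne.symm hji)) hx hj

/-- Near a regular point the meshed region is the element. -/
theorem IsRegular.eventually {i : M.ι} {x : Space d} (hx : IsRegular i x) :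
    ∀ᶠ y in 𝓝 x, (y ∈ closure M.domain ↔ y ∈ M.cell i) := by
  have h : ∀ᶠ y in 𝓝 x, ∀ j, j ≠ i → y ∉ M.cell j := by
    rw [Filter.eventually_all]
    intro j
    by_cases hj : j = i
    · simp [hj]
    · filter_upwards [(M.isClosed_cell j).isOpen_compl.mem_nhds fun h => hj ((hx j).1 h)]
        with y hy _ using hy
  filter_upwards [h] with y hy
  rw [M.closure_domain, Set.mem_iUnion]
  refine ⟨fun ⟨j, hj⟩ => ?_, fun h => ⟨i, h⟩⟩
  by_contra hcon
  exact hy j (fun hji => hcon (hji ▸ hj)) hj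

/-- Near the common point the two elements are half-spaces with opposite normals and a common
bounding hyperplane, so together they fill a neighbourhood. -/
theorem domain_mem_nhds_of_two {i j : M.ι} (hij : i ≠ j) {p q : Space d × ℝ} (hp : p ∈ M.faces i)
    (hq : q ∈ M.faces j) {x : Space d} (hxp : x ∈ facet (M.faces i) p)
    (hxq : x ∈ facet (M.faces j) q) : x ∈ M.domain := by
  have hneg := normal_eq_neg hij hp hq hxp hxq
  rw [domain, mem_interior_iff_mem_nhds]
  filter_upwards [eventually_mem_polyhedron_iff hp hxp, eventually_mem_polyhedron_iff hq hxq]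
    with y hy1 hy2
  rw [← M.cell_eq] at hy1 hy2
  have h1 := hxp.1
  have h2 := hxq.1
  rw [hneg, inner_neg_left] at h2 hy2
  rcases le_total (inner ℝ p.1 y) p.2 with h | h
  · exact Set.mem_iUnion.2 ⟨i, hy1.2 h⟩
  · exact Set.mem_iUnion.2 ⟨j, hy2.2 (by linarith)⟩

/-- Off the edges, a boundary point lies on a facet of exactly one element, whose normal is the
normal of the domain. -/
theorem exists_facet_of_mem_boundary {x : Space d} (hx : x ∈ M.boundary) (hxe : x ∉ M.edges) :
    ∃ i, IsRegular i x ∧ ∃ p ∈ M.faces i, x ∈ facet (M.faces i) p ∧ normal M.domain x = p.1 := by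
  have hxd : x ∉ M.domain := fun h => hx.2 (by rwa [M.isOpen_domain.interior_eq])
  have hfacet : ∀ j, x ∈ M.cell j → ∃ p ∈ M.faces j, x ∈ facet (M.faces j) p := fun j hj =>
    mem_facet_of_mem_cell hxe hj fun h => hxd (M.interior_cell_subset_domain j h)
  obtain ⟨i, hi⟩ := Set.mem_iUnion.1 (M.boundary_subset hx)
  obtain ⟨p, hp, hxp⟩ := hfacet i hi
  have hreg : IsRegular i x := by
    refine fun j => ⟨fun hj => ?_, fun h => h ▸ hi⟩
    by_contra hji
    obtain ⟨q, hq, hxq⟩ := hfacet j hj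
    exact hxd (domain_mem_nhds_of_two hji hq hp hxq hxp)
  refine ⟨i, hreg, p, hp, hxp, IsOutwardNormal.normal_eq ⟨(M.isReduced_faces i).1 p hp, ?_⟩⟩
  have h1 := hreg.eventually.and (eventually_mem_polyhedron_iff hp hxp)
  have h2 : ∀ᶠ y in 𝓝 x, (y ∈ ⋃ i, M.cell i ↔ inner ℝ p.1 y ≤ p.2) := by
    filter_upwards [h1] with y hy
    rw [← M.closure_domain, hy.1, M.cell_eq, hy.2]
  have hpn := (M.isReduced_faces i).1 p hp
  -- The domain is the interior of the union, so the closed half-space description is needed on a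
  -- neighbourhood of `y`: a small step along the normal from an interior point stays in the union,
  -- which turns `≤` into `<`.
  filter_upwards [h2.eventually_nhds] with y hy
  rw [inner_sub_right, hxp.1, sub_neg]
  constructor
  · intro hyd
    have h3 := (mem_interior_iff_mem_nhds.1 hyd)
    have h4 := (tendsto_add_smul y p.1).eventually (hy.and h3)
    obtain ⟨t, ⟨ha, hb⟩, ht0⟩ := ((h4.filter_mono nhdsWithin_le_nhds).and
      (self_mem_nhdsWithin : Set.Ioi (0 : ℝ) ∈ 𝓝[>] 0)).exists
    have ht : (0 : ℝ) < t := ht0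
    have h5 := ha.1 hb
    rw [inner_add_smul_normal hpn] at h5
    linarith
  · intro hlt
    rw [domain, mem_interior_iff_mem_nhds]
    have hc : Continuous fun y : Space d => (inner ℝ p.1 y : ℝ) := by fun_prop
    filter_upwards [hy, hc.continuousAt.eventually_lt_const hlt] with z hz hz2
    exact hz.2 hz2.le

/-- The normal of an element on its facets, zero elsewhere. -/
def facetNormal (i : M.ι) (x : Space d) : Space d :=
  ∑ p ∈ M.faces i, (facet (M.faces i) p).indicator (fun _ => p.1) x

theorem facetNormal_eq {i : M.ι} {p : Space d × ℝ} (hp : p ∈ M.faces i) {x : Space d}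
    (hx : x ∈ facet (M.faces i) p) : facetNormal i x = p.1 := by
  rw [facetNormal, Finset.sum_eq_single_of_mem p hp, Set.indicator_of_mem hx]
  intro q hq hqp
  exact Set.indicator_of_notMem (fun h => hqp (facet_unique hp h hx)) _

theorem facetNormal_eq_zero {i : M.ι} {x : Space d} (hx : ∀ p ∈ M.faces i, x ∉ facet (M.faces i) p) :
    facetNormal i x = 0 :=
  Finset.sum_eq_zero fun p hp => Set.indicator_of_notMem (hx p hp) _

theorem facetNormal_eq_zero_of_notMem {i : M.ι} {x : Space d} (hx : x ∉ M.cell i) :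
    facetNormal i x = 0 :=
  facetNormal_eq_zero fun _ _ h => hx (facet_subset_cell h)

theorem measurable_facetNormal (i : M.ι) : Measurable (facetNormal i) :=
  Finset.measurable_sum _ fun p _ => measurable_const.indicator (measurableSet_facet _ p)

/-- Off the edges, the element normals cancel in the interior and add up to the normal of the
domain on the boundary. -/
theorem sum_facetNormal {x : Space d} (hx : x ∉ M.edges) :
    ∑ i : M.ι, facetNormal i x = M.boundary.indicator (normal M.domain) x := by
  by_cases hb : x ∈ M.boundary
  · obtain ⟨i, hreg, p, hp, hxp, hn⟩ := exists_facet_of_mem_boundary hb hx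
    rw [Set.indicator_of_mem hb, hn, Finset.sum_eq_single_of_mem i (Finset.mem_univ i),
      facetNormal_eq hp hxp]
    exact fun j _ hji => facetNormal_eq_zero_of_notMem fun h => hji ((hreg j).1 h)
  rw [Set.indicator_of_notMem hb]
  by_cases hall : ∀ i, ∀ p ∈ M.faces i, x ∉ facet (M.faces i) p
  · exact Finset.sum_eq_zero fun i _ => facetNormal_eq_zero (hall i)
  push Not at hall
  obtain ⟨i, p, hp, hxp⟩ := hall
  have hxd : x ∈ M.domain := by
    by_contra h
    refine hb ⟨?_, by rwa [M.isOpen_domain.interior_eq]⟩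
    rw [M.closure_domain]
    exact Set.mem_iUnion.2 ⟨i, facet_subset_cell hxp⟩
  -- If element `i` were alone at `x`, it would fill a neighbourhood of this interior point of the
  -- domain, and `x` could not lie on a facet.
  obtain ⟨j, hji, hj⟩ : ∃ j, j ≠ i ∧ x ∈ M.cell j := by
    by_contra! hcon
    have hreg : IsRegular i x := fun j =>
      ⟨fun hj => by_contra fun hji => hcon j hji hj, fun h => h ▸ facet_subset_cell hxp⟩
    refine facet_not_interior hp hxp (mem_interior_iff_mem_nhds.2 ?_)
    filter_upwards [hreg.eventually, M.isOpen_domain.mem_nhds hxd] with y hy hyd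
    exact hy.1 (subset_closure hyd)
  have hnotint : ∀ k, x ∉ interior (M.cell k) := by
    intro k hk
    have h1 := (isRegular_of_mem_interior hk i).1 (facet_subset_cell hxp)
    have h2 := (isRegular_of_mem_interior hk j).1 hj
    exact hji (h2.trans h1.symm)
  obtain ⟨q, hq, hxq⟩ := mem_facet_of_mem_cell hx hj (hnotint j)
  have hneg := normal_eq_neg hji.symm hp hq hxp hxq
  rw [Fintype.sum_eq_add i j hji.symm, facetNormal_eq hp hxp, facetNormal_eq hq hxq, hneg,
    add_neg_cancel]
  rintro k ⟨hki, hkj⟩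
  -- A third element with a facet through `x` would need a normal opposite to both `p.1` and `-p.1`.
  refine facetNormal_eq_zero fun r hr hxr => ?_
  have h1 := normal_eq_neg hki.symm hp hr hxp hxr
  have h2 := normal_eq_neg hkj.symm hq hr hxq hxr
  rw [h2, hneg, neg_neg] at h1
  have h3 : ‖p.1‖ = 1 := (M.isReduced_faces i).1 p hp
  have h4 : inner ℝ p.1 p.1 = (1 : ℝ) := by rw [real_inner_self_eq_norm_sq, h3, one_pow]
  have h5 : inner ℝ p.1 p.1 = -inner ℝ p.1 p.1 := by
    conv_lhs => rw [h1, inner_neg_left, ← h1]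
  linarith

theorem surface_boundary_lt_top (hd : 1 ≤ d) : surface d M.boundary < ∞ := by
  have hsub : M.boundary ⊆ M.edges ∪ ⋃ i, ⋃ p ∈ M.faces i, facet (M.faces i) p := by
    intro x hx
    by_cases hxe : x ∈ M.edges
    · exact Or.inl hxe
    · obtain ⟨i, -, p, hp, hxp, -⟩ := exists_facet_of_mem_boundary hx hxe
      exact Or.inr (Set.mem_iUnion.2 ⟨i, Set.mem_iUnion₂.2 ⟨p, hp, hxp⟩⟩)
  refine (measure_mono hsub).trans_lt ((measure_union_le _ _).trans_lt ?_)
  rw [M.surface_edges hd, zero_add]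
  refine (measure_iUnion_le _).trans_lt ?_
  rw [tsum_fintype, ENNReal.sum_lt_top]
  intro i _
  refine (measure_biUnion_finset_le _ _).trans_lt (ENNReal.sum_lt_top.2 fun p hp => ?_)
  exact facet_measure_lt_top hd (M.isReduced_faces i) (M.isBounded_faces i) hp

end Mesh

namespace Mesh

variable {M : Mesh d}

/-! ### Piecewise smooth functions on a mesh -/

/-- `v` is a family of `C²` functions that agree with `w` on the elements. -/
def IsPieces (M : Mesh d) (w : Space d → ℝ) (v : M.ι → Space d → ℝ) : Prop :=
  ∀ i, ContDiff ℝ 2 (v i) ∧ Set.EqOn w (v i) (M.cell i)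

theorem uniqueDiffOn_cell (i : M.ι) : UniqueDiffOn ℝ (M.cell i) :=
  uniqueDiffOn_convex (M.convex_cell i) (M.nonempty_interior i)

theorem IsRegular.mem {i : M.ι} {x : Space d} (h : IsRegular i x) : x ∈ M.cell i := (h i).2 rfl

/-- A derivative within a set depends only on the set near the point, and near a regular point the
meshed region is one convex element with interior, on which derivatives are unique. The argument
covers regular boundary points as well as interior ones. -/
theorem grad_eq {i : M.ι} {x : Space d} (hx : IsRegular i x) {w v : Space d → ℝ}
    (hv : DifferentiableAt ℝ v x) (hwv : Set.EqOn w v (M.cell i)) : M.grad w x = gradient v x := by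
  rw [grad, gradientWithin, gradient,
    fderivWithin_congr_set (Filter.eventuallyEq_set.2 hx.eventually),
    fderivWithin_congr hwv (hwv hx.mem), hv.fderivWithin (M.uniqueDiffOn_cell i x hx.mem)]

theorem IsPieces.differentiable {w : Space d → ℝ} {v : M.ι → Space d → ℝ} (h : M.IsPieces w v)
    (i : M.ι) : Differentiable ℝ (v i) := (h i).1.differentiable two_ne_zero

theorem IsPieces.grad_eq {w : Space d → ℝ} {v : M.ι → Space d → ℝ} (h : M.IsPieces w v)
    {i : M.ι} {x : Space d} (hx : IsRegular i x) : M.grad w x = gradient (v i) x :=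
  Mesh.grad_eq hx (h.differentiable i x) (h i).2

theorem IsPieces.laplacian_eq {w : Space d → ℝ} {v : M.ι → Space d → ℝ} (h : M.IsPieces w v)
    {i : M.ι} {x : Space d} (hx : x ∈ interior (M.cell i)) :
    Laplacian.laplacian w x = Laplacian.laplacian (v i) x :=
  (InnerProductSpace.laplacian_congr_nhds ((h i).2.eventuallyEq_of_mem
    (mem_interior_iff_mem_nhds.1 hx))).eq_of_nhds

theorem ae_interior (M : Mesh d) :
    ∀ᵐ x ∂(volume.restrict M.domain), ∃ i, x ∈ interior (M.cell i) := by
  rw [← Measure.restrict_congr_set M.domain_ae_eq_openCells]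
  filter_upwards [ae_restrict_mem M.isOpen_openCells.measurableSet] with x hx
    using Set.mem_iUnion.1 hx

theorem ae_regular_domain (M : Mesh d) :
    ∀ᵐ x ∂(volume.restrict M.domain), ∃ i : M.ι, IsRegular i x := by
  filter_upwards [M.ae_interior] with x ⟨i, hi⟩ using ⟨i, isRegular_of_mem_interior hi⟩

theorem ae_not_edges (M : Mesh d) (hd : 1 ≤ d) : ∀ᵐ x ∂(surface d), x ∉ M.edges :=
  measure_eq_zero_iff_ae_notMem.1 (M.surface_edges hd)

theorem ae_regular_boundary (M : Mesh d) (hd : 1 ≤ d) :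
    ∀ᵐ x ∂((surface d).restrict M.boundary), ∃ i : M.ι, IsRegular i x := by
  filter_upwards [ae_restrict_mem M.isClosed_boundary.measurableSet,
    ae_restrict_of_ae (M.ae_not_edges hd)] with x hx hxe
  obtain ⟨i, hi, -⟩ := exists_facet_of_mem_boundary hx hxe
  exact ⟨i, hi⟩

/-- Each piece is bounded on its compact element, and measurability comes from the sum of the pieces
cut off to their elements: at a regular point exactly one summand survives. -/
theorem memLp_top_of_pieces {F : Type*} [NormedAddCommGroup F] {m : Measure (Space d)}
    {f : Space d → F} {g : M.ι → Space d → F} (hg : ∀ i, Continuous (g i))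
    (h : ∀ᵐ x ∂m, ∃ i, IsRegular i x ∧ f x = g i x) : MemLp f ∞ m := by
  choose C hC using fun i => (M.isCompact_cell i).exists_bound_of_continuousOn (hg i).continuousOn
  have hC0 : ∀ i, 0 ≤ C i := fun i => by
    obtain ⟨x, hx⟩ := M.nonempty_interior i
    exact (norm_nonneg _).trans (hC i x (interior_subset hx))
  refine memLp_top_of_bound (C := ∑ i, C i) ?_ ?_
  · have hm : AEStronglyMeasurable (fun x => ∑ i, (M.cell i).indicator (g i) x) m :=
      Finset.aestronglyMeasurable_fun_sum _ fun i _ =>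
        (hg i).aestronglyMeasurable.indicator (M.isClosed_cell i).measurableSet
    refine hm.congr ?_
    filter_upwards [h] with x ⟨i, hi, hfx⟩
    rw [Finset.sum_eq_single_of_mem i (Finset.mem_univ i), Set.indicator_of_mem hi.mem, hfx]
    exact fun j _ hji => Set.indicator_of_notMem (fun hj => hji ((hi j).1 hj)) _
  · filter_upwards [h] with x ⟨i, hi, hfx⟩
    rw [hfx]
    exact (hC i x hi.mem).trans (Finset.single_le_sum (fun j _ => hC0 j) (Finset.mem_univ i))

theorem continuous_gradient {v : Space d → ℝ} (hv : ContDiff ℝ 2 v) : Continuous (gradient v) :=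
  (InnerProductSpace.toDual ℝ (Space d)).symm.continuous.comp (hv.continuous_fderiv two_ne_zero)

theorem continuous_laplacian {v : Space d → ℝ} (hv : ContDiff ℝ 2 v) :
    Continuous (Laplacian.laplacian v) := by
  rw [InnerProductSpace.laplacian_eq_iteratedFDeriv_stdOrthonormalBasis]
  refine continuous_finsetSum _ fun i _ => ?_
  have h := hv.continuous_iteratedFDeriv (m := 2) le_rfl
  exact (ContinuousMultilinearMap.apply ℝ (fun _ : Fin 2 => Space d) ℝ _).continuous.comp h

theorem IsPieces.memLp_top {w : Space d → ℝ} {v : M.ι → Space d → ℝ} (h : M.IsPieces w v)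
    {m : Measure (Space d)} (hm : ∀ᵐ x ∂m, ∃ i : M.ι, IsRegular i x) : MemLp w ∞ m :=
  memLp_top_of_pieces (fun i => (h i).1.continuous) <| by
    filter_upwards [hm] with x ⟨i, hi⟩ using ⟨i, hi, (h i).2 hi.mem⟩

theorem IsPieces.memLp_top_grad {w : Space d → ℝ} {v : M.ι → Space d → ℝ} (h : M.IsPieces w v)
    {m : Measure (Space d)} (hm : ∀ᵐ x ∂m, ∃ i : M.ι, IsRegular i x) : MemLp (M.grad w) ∞ m :=
  memLp_top_of_pieces (fun i => continuous_gradient (h i).1) <| by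
    filter_upwards [hm] with x ⟨i, hi⟩ using ⟨i, hi, h.grad_eq hi⟩

theorem IsPieces.memLp_top_laplacian {w : Space d → ℝ} {v : M.ι → Space d → ℝ}
    (h : M.IsPieces w v) : MemLp (Laplacian.laplacian w) ∞ (volume.restrict M.domain) :=
  memLp_top_of_pieces (fun i => continuous_laplacian (h i).1) <| by
    filter_upwards [M.ae_interior] with x ⟨i, hi⟩
      using ⟨i, isRegular_of_mem_interior hi, h.laplacian_eq hi⟩

/-- The normal field is defined by choice; its measurability comes from agreeing almost everywhere
on the boundary with the finite sum of facet normals. -/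
theorem memLp_top_normal (M : Mesh d) (hd : 1 ≤ d) :
    MemLp (normal M.domain) ∞ ((surface d).restrict M.boundary) := by
  refine memLp_top_of_bound (C := 1) ?_
    (Filter.Eventually.of_forall (norm_normal_le M.domain))
  have hm : Measurable fun x => ∑ i : M.ι, facetNormal i x :=
    Finset.measurable_fun_sum _ fun i _ => measurable_facetNormal i
  refine hm.aestronglyMeasurable.congr ?_
  filter_upwards [ae_restrict_mem M.isClosed_boundary.measurableSet,
    ae_restrict_of_ae (M.ae_not_edges hd)] with x hx hxe
  rw [sum_facetNormal hxe, Set.indicator_of_mem hx]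

theorem volume_domain_lt_top (M : Mesh d) : volume M.domain < ∞ := by
  refine (measure_mono interior_subset).trans_lt ((measure_iUnion_le _).trans_lt ?_)
  rw [tsum_fintype, ENNReal.sum_lt_top]
  exact fun i _ => (M.isCompact_cell i).measure_lt_top

instance (M : Mesh d) : IsFiniteMeasure (volume.restrict M.domain) :=
  ⟨by simpa using M.volume_domain_lt_top⟩

theorem isFiniteMeasure_boundary (M : Mesh d) (hd : 1 ≤ d) :
    IsFiniteMeasure ((surface d).restrict M.boundary) :=
  ⟨by simpa using surface_boundary_lt_top (M := M) hd⟩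

/-- **Divergence theorem** on a mesh, for a constant vector field times a continuous piecewise
smooth function. -/
theorem IsPieces.integral_inner_grad (hd : 1 ≤ d) {u : Space d → ℝ} {v : M.ι → Space d → ℝ}
    (h : M.IsPieces u v) (a : Space d) :
    ∫ x in M.domain, inner ℝ a (M.grad u x) =
      ∫ x in M.boundary, M.normalComp a x * u x ∂(surface d) := by
  have h1 : ∀ i, ∀ x ∈ interior (M.cell i), inner ℝ a (M.grad u x) = fderiv ℝ (v i) x a := by
    intro i x hx
    rw [h.grad_eq (isRegular_of_mem_interior hx), real_inner_comm, inner_gradient_left]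
  have hint : Integrable (fun x => inner ℝ a (M.grad u x)) (volume.restrict M.domain) :=
    ((h.memLp_top_grad M.ae_regular_domain).integrable (by simp)).const_inner a
  have hL : ∫ x in M.domain, inner ℝ a (M.grad u x) =
      ∑ i, ∫ x in interior (M.cell i), fderiv ℝ (v i) x a := by
    rw [← setIntegral_congr_set M.domain_ae_eq_openCells, openCells,
      integral_iUnion_fintype (fun i => isOpen_interior.measurableSet) M.disjoint_interior
        (fun i => IntegrableOn.mono_set hint (M.interior_cell_subset_domain i))]
    exact Finset.sum_congr rfl fun i _ =>
      setIntegral_congr_fun isOpen_interior.measurableSet (h1 i)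
  have hfi : ∀ i, ∀ p ∈ M.faces i, Integrable ((facet (M.faces i) p).indicator
      fun x => inner ℝ a p.1 * v i x) (surface d) := by
    intro i p hp
    rw [integrable_indicator_iff (measurableSet_facet _ _)]
    obtain ⟨C, R, -, hC⟩ := exists_bound_polyhedron (M.isBounded_faces i) (h i).1.continuous
    refine Integrable.const_mul ?_ _
    refine Measure.integrableOn_of_bounded (M := C)
      (facet_measure_lt_top hd (M.isReduced_faces i) (M.isBounded_faces i) hp).ne
      (h i).1.continuous.aestronglyMeasurable ?_
    filter_upwards [ae_restrict_mem (measurableSet_facet _ _)] with x hx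
      using (hC x (facet_subset hx)).1
  have hR : ∫ x in M.boundary, M.normalComp a x * u x ∂(surface d) =
      ∑ i, ∑ p ∈ M.faces i, inner ℝ a p.1 * ∫ x in facet (M.faces i) p, v i x ∂(surface d) := by
    rw [← integral_indicator M.isClosed_boundary.measurableSet]
    -- Contributions of neighbouring elements cancel because all pieces take the single value `u x`
    -- on a shared facet while the facet normals add up to zero.
    have hpt : ∀ᵐ x ∂(surface d), M.boundary.indicator (fun x => M.normalComp a x * u x) x =
        ∑ i, ∑ p ∈ M.faces i, (facet (M.faces i) p).indicator
          (fun x => inner ℝ a p.1 * v i x) x := by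
      filter_upwards [M.ae_not_edges hd] with x hx
      have h2 : M.boundary.indicator (fun x => M.normalComp a x * u x) x =
          inner ℝ a (∑ i : M.ι, facetNormal i x) * u x := by
        rw [sum_facetNormal hx]
        by_cases hb : x ∈ M.boundary
        · simp [hb, normalComp]
        · simp [hb]
      rw [h2, inner_sum, Finset.sum_mul]
      refine Finset.sum_congr rfl fun i _ => ?_
      rw [facetNormal, inner_sum, Finset.sum_mul]
      refine Finset.sum_congr rfl fun p _ => ?_
      by_cases hxp : x ∈ facet (M.faces i) p
      · simp [hxp, (h i).2 (facet_subset_cell hxp)]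
      · simp [hxp]
    rw [integral_congr_ae hpt, integral_finsetSum _ fun i _ => integrable_finsetSum _ (hfi i)]
    refine Finset.sum_congr rfl fun i _ => ?_
    rw [integral_finsetSum _ (hfi i)]
    refine Finset.sum_congr rfl fun p _ => ?_
    rw [integral_indicator (measurableSet_facet _ _), integral_const_mul]
  rw [hL, hR]
  refine Finset.sum_congr rfl fun i _ => ?_
  rw [M.interior_cell, integral_polyhedron_fderiv hd (M.isReduced_faces i) (M.isBounded_faces i)
    ((h i).1.of_le one_le_two)]

end Mesh

/-! ### Forms given by integrals -/

theorem integrable_inner_of_memLp {X F : Type*} [MeasurableSpace X] {m : Measure X}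
    [IsFiniteMeasure m] [NormedAddCommGroup F] [InnerProductSpace ℝ F] {f g : X → F}
    (hf : MemLp f ∞ m) (hg : MemLp g 2 m) : Integrable (fun x => (inner ℝ (f x) (g x) : ℝ)) m := by
  have h : Integrable (fun x => ‖f x‖ * ‖g x‖) m :=
    (hg.norm.mul (r := 2) hf.norm).integrable (by norm_num)
  refine h.mono (hf.1.inner hg.1) (Filter.Eventually.of_forall fun x => ?_)
  rw [norm_mul, norm_norm, norm_norm]
  exact norm_inner_le_norm _ _

theorem memLp_two_of_top {X F : Type*} [MeasurableSpace X] {m : Measure X}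
    [IsFiniteMeasure m] [NormedAddCommGroup F] {f : X → F} (hf : MemLp f ∞ m) : MemLp f 2 m :=
  hf.mono_exponent le_top

/-- Operators on a function space that are linear and bounded almost everywhere. -/
structure IsLinearAE {F : Type*} [NormedAddCommGroup F] [NormedSpace ℝ F]
    (W : Submodule ℝ (Space d → ℝ)) (m : Measure (Space d))
    (D : (Space d → ℝ) → Space d → F) : Prop where
  memLp : ∀ w ∈ W, MemLp (D w) ∞ m
  add : ∀ w ∈ W, ∀ w' ∈ W, ∀ᵐ x ∂m, D (w + w') x = D w x + D w' x
  smul : ∀ (c : ℝ), ∀ w ∈ W, ∀ᵐ x ∂m, D (c • w) x = c • D w x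

namespace IsLinearAE

variable {F : Type*} [NormedAddCommGroup F] [InnerProductSpace ℝ F]
  {W : Submodule ℝ (Space d → ℝ)} {m m' : Measure (Space d)}
  {D E : (Space d → ℝ) → Space d → F} {T : (Space d → ℝ) → Space d → ℝ}

theorem mono (h : IsLinearAE W m D) (hm : m' ≤ m) : IsLinearAE W m' D where
  memLp w hw := (h.memLp w hw).mono_measure hm
  add w hw w' hw' := (h.add w hw w' hw').filter_mono (ae_mono hm)
  smul c w hw := (h.smul c w hw).filter_mono (ae_mono hm)

theorem sub (hD : IsLinearAE W m D) (hE : IsLinearAE W m E) :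
    IsLinearAE W m fun w x => D w x - E w x where
  memLp w hw := (hD.memLp w hw).sub (hE.memLp w hw)
  add w hw w' hw' := by
    filter_upwards [hD.add w hw w' hw', hE.add w hw w' hw'] with x h1 h2
    rw [h1, h2]; abel
  smul c w hw := by
    filter_upwards [hD.smul c w hw, hE.smul c w hw] with x h1 h2
    rw [h1, h2, smul_sub]

theorem mul_left (hT : IsLinearAE W m T) {g : Space d → ℝ} (hg : MemLp g ∞ m) :
    IsLinearAE W m fun w x => g x * T w x where
  memLp w hw := (hT.memLp w hw).mul hg
  add w hw w' hw' := by
    filter_upwards [hT.add w hw w' hw'] with x h1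
    rw [h1]; ring
  smul c w hw := by
    filter_upwards [hT.smul c w hw] with x h1
    rw [h1, smul_eq_mul, smul_eq_mul]; ring

theorem const_mul [IsFiniteMeasure m] (hT : IsLinearAE W m T) (c : ℝ) :
    IsLinearAE W m fun w x => c * T w x :=
  hT.mul_left (memLp_const c)

theorem mul_const [IsFiniteMeasure m] (hT : IsLinearAE W m T) (c : ℝ) :
    IsLinearAE W m fun w x => T w x * c := by
  simpa only [mul_comm] using hT.const_mul c

theorem inner_left [IsFiniteMeasure m] (hD : IsLinearAE W m D) {g : Space d → F}
    (hg : MemLp g ∞ m) : IsLinearAE W m fun w x => (inner ℝ (g x) (D w x) : ℝ) where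
  memLp w hw := by
    have h := (hD.memLp w hw).norm.mul (r := ∞) hg.norm
    refine h.mono (hg.1.inner (hD.memLp w hw).1) (Filter.Eventually.of_forall fun x => ?_)
    rw [Pi.mul_apply, norm_mul, norm_norm, norm_norm]
    exact norm_inner_le_norm _ _
  add w hw w' hw' := by
    filter_upwards [hD.add w hw w' hw'] with x h1
    rw [h1, inner_add_right]
  smul c w hw := by
    filter_upwards [hD.smul c w hw] with x h1
    rw [h1, inner_smul_right, smul_eq_mul]

end IsLinearAE

/-- `T` restricts to a linear functional on `W`. -/
def IsLin (W : Submodule ℝ (Space d → ℝ)) (T : (Space d → ℝ) → ℝ) : Prop :=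
  ∃ l : W →ₗ[ℝ] ℝ, ∀ w : W, l w = T w

/-- `T` restricts to a bilinear form on `W`. -/
def IsBilin (W : Submodule ℝ (Space d → ℝ)) (T : (Space d → ℝ) → (Space d → ℝ) → ℝ) : Prop :=
  ∃ b : W →ₗ[ℝ] W →ₗ[ℝ] ℝ, ∀ w φ : W, b w φ = T w φ

section

variable {F : Type*} [NormedAddCommGroup F] [InnerProductSpace ℝ F]
  {W : Submodule ℝ (Space d → ℝ)} {m : Measure (Space d)}

theorem IsLin.add {S T : (Space d → ℝ) → ℝ} (hS : IsLin W S) (hT : IsLin W T) :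
    IsLin W fun w => S w + T w := by
  obtain ⟨k, hk⟩ := hS
  obtain ⟨l, hl⟩ := hT
  exact ⟨k + l, fun w => by simp [hk, hl]⟩

theorem IsLin.sub {S T : (Space d → ℝ) → ℝ} (hS : IsLin W S) (hT : IsLin W T) :
    IsLin W fun w => S w - T w := by
  obtain ⟨k, hk⟩ := hS
  obtain ⟨l, hl⟩ := hT
  exact ⟨k - l, fun w => by simp [hk, hl]⟩

theorem IsBilin.add {S T : (Space d → ℝ) → (Space d → ℝ) → ℝ} (hS : IsBilin W S)
    (hT : IsBilin W T) : IsBilin W fun w φ => S w φ + T w φ := by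
  obtain ⟨k, hk⟩ := hS
  obtain ⟨l, hl⟩ := hT
  exact ⟨k + l, fun w φ => by simp [hk, hl]⟩

theorem IsBilin.sub {S T : (Space d → ℝ) → (Space d → ℝ) → ℝ} (hS : IsBilin W S)
    (hT : IsBilin W T) : IsBilin W fun w φ => S w φ - T w φ := by
  obtain ⟨k, hk⟩ := hS
  obtain ⟨l, hl⟩ := hT
  exact ⟨k - l, fun w φ => by simp [hk, hl]⟩

theorem IsBilin.neg {S : (Space d → ℝ) → (Space d → ℝ) → ℝ} (hS : IsBilin W S) :
    IsBilin W fun w φ => -S w φ := by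
  obtain ⟨k, hk⟩ := hS
  exact ⟨-k, fun w φ => by simp [hk]⟩

theorem IsLinearAE.isLin [IsFiniteMeasure m] {D : (Space d → ℝ) → Space d → ℝ}
    (hD : IsLinearAE W m D) {f : Space d → ℝ} (hf : MemLp f 2 m) :
    IsLin W fun w => ∫ x, D w x * f x ∂m := by
  have hi : ∀ w ∈ W, Integrable (fun x => D w x * f x) m := fun w hw =>
    (hf.mul (r := 2) (hD.memLp w hw)).integrable (by norm_num)
  refine ⟨{ toFun := fun w => ∫ x, D w x * f x ∂m, map_add' := ?_, map_smul' := ?_ },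
    fun w => rfl⟩
  · intro w w'
    rw [← integral_add (hi _ w.2) (hi _ w'.2)]
    refine integral_congr_ae ?_
    filter_upwards [hD.add w w.2 w' w'.2] with x hx
    rw [Submodule.coe_add, hx]; ring
  · intro c w
    rw [RingHom.id_apply, smul_eq_mul, ← integral_const_mul]
    refine integral_congr_ae ?_
    filter_upwards [hD.smul c w w.2] with x hx
    rw [Submodule.coe_smul, hx, smul_eq_mul]; ring

theorem IsLinearAE.isBilin_inner [IsFiniteMeasure m] {D E : (Space d → ℝ) → Space d → F}
    (hD : IsLinearAE W m D) (hE : IsLinearAE W m E) :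
    IsBilin W fun w φ => ∫ x, inner ℝ (D w x) (E φ x) ∂m := by
  have hi : ∀ w ∈ W, ∀ φ ∈ W, Integrable (fun x => (inner ℝ (D w x) (E φ x) : ℝ)) m :=
    fun w hw φ hφ => integrable_inner_of_memLp (hD.memLp w hw) (memLp_two_of_top (hE.memLp φ hφ))
  refine ⟨LinearMap.mk₂ ℝ (fun w φ => ∫ x, inner ℝ (D w x) (E φ x) ∂m) ?_ ?_ ?_ ?_,
    fun w φ => rfl⟩
  · intro w w' φ
    rw [← integral_add (hi _ w.2 _ φ.2) (hi _ w'.2 _ φ.2)]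
    refine integral_congr_ae ?_
    filter_upwards [hD.add w w.2 w' w'.2] with x hx
    rw [Submodule.coe_add, hx, inner_add_left]
  · intro c w φ
    rw [smul_eq_mul, ← integral_const_mul]
    refine integral_congr_ae ?_
    filter_upwards [hD.smul c w w.2] with x hx
    rw [Submodule.coe_smul, hx, inner_smul_left, conj_trivial]
  · intro w φ φ'
    rw [← integral_add (hi _ w.2 _ φ.2) (hi _ w.2 _ φ'.2)]
    refine integral_congr_ae ?_
    filter_upwards [hE.add φ φ.2 φ' φ'.2] with x hx
    rw [Submodule.coe_add, hx, inner_add_right]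
  · intro c w φ
    rw [smul_eq_mul, ← integral_const_mul]
    refine integral_congr_ae ?_
    filter_upwards [hE.smul c φ φ.2] with x hx
    rw [Submodule.coe_smul, hx, inner_smul_right]

theorem IsLinearAE.isBilin [IsFiniteMeasure m] {D E : (Space d → ℝ) → Space d → ℝ}
    (hD : IsLinearAE W m D) (hE : IsLinearAE W m E) :
    IsBilin W fun w φ => ∫ x, D w x * E φ x ∂m := by
  obtain ⟨b, hb⟩ := hD.isBilin_inner hE
  refine ⟨b, fun w φ => (hb w φ).trans (integral_congr_ae (Filter.Eventually.of_forall fun x => ?_))⟩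
  simp [mul_comm]

end

/-! ### The operators of the discrete formulation -/

section

variable {M : Mesh d} {W : Submodule ℝ (Space d → ℝ)} {m : Measure (Space d)}

open Mesh

theorem IsFESpace.exists_pieces (hW : IsFESpace M W) {w : Space d → ℝ} (hw : w ∈ W) :
    ∃ v, M.IsPieces w v := by
  choose v hv using hW.piecewise w hw
  exact ⟨v, hv⟩

theorem IsFESpace.isLinearAE_id (hW : IsFESpace M W)
    (hm : ∀ᵐ x ∂m, ∃ i : M.ι, IsRegular i x) : IsLinearAE W m fun w x => w x where
  memLp w hw := by
    obtain ⟨v, hv⟩ := hW.exists_pieces hw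
    exact hv.memLp_top hm
  add w _ w' _ := Filter.Eventually.of_forall fun _ => rfl
  smul c w _ := Filter.Eventually.of_forall fun _ => rfl

theorem gradient_add {v v' : Space d → ℝ} {x : Space d} (hv : DifferentiableAt ℝ v x)
    (hv' : DifferentiableAt ℝ v' x) : gradient (v + v') x = gradient v x + gradient v' x := by
  rw [gradient, fderiv_add hv hv', map_add]; rfl

theorem gradient_smul {v : Space d → ℝ} {x : Space d} (c : ℝ) (hv : DifferentiableAt ℝ v x) :
    gradient (c • v) x = c • gradient v x := by
  rw [gradient, fderiv_const_smul hv, map_smulₛₗ]; rfl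

theorem IsFESpace.isLinearAE_grad (hW : IsFESpace M W)
    (hm : ∀ᵐ x ∂m, ∃ i : M.ι, IsRegular i x) : IsLinearAE W m fun w x => M.grad w x where
  memLp w hw := by
    obtain ⟨v, hv⟩ := hW.exists_pieces hw
    exact hv.memLp_top_grad hm
  add w hw w' hw' := by
    obtain ⟨v, hv⟩ := hW.exists_pieces hw
    obtain ⟨v', hv'⟩ := hW.exists_pieces hw'
    filter_upwards [hm] with x ⟨i, hi⟩
    rw [hv.grad_eq hi, hv'.grad_eq hi, ← gradient_add (hv.differentiable i x)
      (hv'.differentiable i x)]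
    exact Mesh.grad_eq hi ((hv.differentiable i x).add (hv'.differentiable i x))
      fun y hy => congrArg₂ (· + ·) ((hv i).2 hy) ((hv' i).2 hy)
  smul c w hw := by
    obtain ⟨v, hv⟩ := hW.exists_pieces hw
    filter_upwards [hm] with x ⟨i, hi⟩
    rw [hv.grad_eq hi, ← gradient_smul c (hv.differentiable i x)]
    exact Mesh.grad_eq hi ((hv.differentiable i x).const_smul c)
      fun y hy => congrArg (c • ·) ((hv i).2 hy)

theorem IsFESpace.isLinearAE_laplacian (hW : IsFESpace M W) :
    IsLinearAE W (volume.restrict M.domain) fun w x => Laplacian.laplacian w x where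
  memLp w hw := by
    obtain ⟨v, hv⟩ := hW.exists_pieces hw
    exact hv.memLp_top_laplacian
  add w hw w' hw' := by
    obtain ⟨v, hv⟩ := hW.exists_pieces hw
    obtain ⟨v', hv'⟩ := hW.exists_pieces hw'
    filter_upwards [M.ae_interior] with x ⟨i, hi⟩
    have h : M.IsPieces (w + w') fun i => v i + v' i := fun i =>
      ⟨(hv i).1.add (hv' i).1, fun y hy => congrArg₂ (· + ·) ((hv i).2 hy) ((hv' i).2 hy)⟩
    rw [h.laplacian_eq hi, hv.laplacian_eq hi, hv'.laplacian_eq hi]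
    exact (hv i).1.contDiffAt.laplacian_add (hv' i).1.contDiffAt
  smul c w hw := by
    obtain ⟨v, hv⟩ := hW.exists_pieces hw
    filter_upwards [M.ae_interior] with x ⟨i, hi⟩
    have h : M.IsPieces (c • w) fun i => c • v i := fun i =>
      ⟨(hv i).1.const_smul c, fun y hy => congrArg (c • ·) ((hv i).2 hy)⟩
    rw [h.laplacian_eq hi, hv.laplacian_eq hi]
    exact InnerProductSpace.laplacian_smul c (hv i).1.contDiffAt

theorem IsFESpace.isLinearAE_inner_grad [IsFiniteMeasure m] (hW : IsFESpace M W)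
    (hm : ∀ᵐ x ∂m, ∃ i : M.ι, IsRegular i x) (a : Space d) :
    IsLinearAE W m fun w x => (inner ℝ a (M.grad w x) : ℝ) :=
  (hW.isLinearAE_grad hm).inner_left (memLp_const a)

theorem memLp_top_normalComp (M : Mesh d) (hd : 1 ≤ d) (a : Space d) :
    MemLp (M.normalComp a) ∞ ((surface d).restrict M.boundary) := by
  have := M.isFiniteMeasure_boundary hd
  exact (M.memLp_top_normal hd).const_inner a

theorem IsFESpace.isLinearAE_normalDeriv (hd : 1 ≤ d) (hW : IsFESpace M W) :
    IsLinearAE W ((surface d).restrict M.boundary) fun w x => M.normalDeriv w x := by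
  have := M.isFiniteMeasure_boundary hd
  exact (hW.isLinearAE_grad (M.ae_regular_boundary hd)).inner_left (M.memLp_top_normal hd)

theorem outflow_subset (M : Mesh d) (a : Space d) (Γ : Set (Space d)) : M.outflow a Γ ⊆ Γ :=
  fun _ h => h.1

theorem inflow_subset (M : Mesh d) (a : Space d) (Γ : Set (Space d)) : M.inflow a Γ ⊆ Γ :=
  fun _ h => h.1

/-- Every term integrates a product of two bounded operators over a finite measure. Linearity almost
everywhere suffices, and it is what is available, since `grad` is only shown to be linear at regular
points. -/
theorem isBilin_B (hd : 1 ≤ d) (hW : IsFESpace M W) {ΓD : Set (Space d)} (hΓD : ΓD ⊆ M.boundary)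
    (a : Space d) (κ β τ γ : ℝ) : IsBilin W (B M ΓD a κ β τ γ) := by
  have hfin := M.isFiniteMeasure_boundary hd
  have hle : ∀ {Γ}, Γ ⊆ M.boundary → (surface d).restrict Γ ≤ (surface d).restrict M.boundary :=
    fun h => Measure.restrict_mono h le_rfl
  have hfin' : ∀ {Γ}, Γ ⊆ M.boundary → IsFiniteMeasure ((surface d).restrict Γ) :=
    fun h => isFiniteMeasure_of_le _ (hle h)
  have hΓp := (outflow_subset M a ΓD).trans hΓD
  have := hfin' hΓD
  have := hfin' hΓp
  have := hfin' (outflow_subset M a M.boundary)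
  have rD := M.ae_regular_domain
  have rB := M.ae_regular_boundary hd
  have iD := hW.isLinearAE_id rD
  have iB := hW.isLinearAE_id rB
  have gD := hW.isLinearAE_grad rD
  have aD := hW.isLinearAE_inner_grad rD a
  have aB := hW.isLinearAE_inner_grad rB a
  have nB := hW.isLinearAE_normalDeriv hd
  have hvol := Measure.restrict_congr_set (μ := volume) M.domain_ae_eq_openCells
  have hA : IsBilin W (BA M a) := (aD.isBilin iD).neg.add
    (((iB.mul_left (memLp_top_normalComp M hd a)).mono
      (hle (outflow_subset M a M.boundary))).isBilin (iB.mono (hle (outflow_subset M a M.boundary))))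
  have hDiff : IsBilin W (BD M ΓD κ β) := by
    refine IsBilin.add (IsBilin.sub (IsBilin.sub ?_ ?_) ?_) ?_
    · have hb := (gD.isBilin_inner gD)
      obtain ⟨b, hb⟩ := hb
      exact ⟨κ • b, fun w φ => by simp [hb, integral_const_mul]⟩
    · exact ((iB.const_mul κ).mono (hle hΓD)).isBilin (nB.mono (hle hΓD))
    · exact ((nB.const_mul κ).mono (hle hΓD)).isBilin (iB.mono (hle hΓD))
    · exact ((iB.const_mul (κ * β)).mono (hle hΓD)).isBilin (iB.mono (hle hΓD))
  have hV : IsBilin W (BVMSvol M a κ τ) := by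
    have h := (aD.mul_const τ).isBilin (aD.sub (hW.isLinearAE_laplacian.const_mul κ))
    rw [← hvol] at h
    exact h
  have hVb : IsBilin W (BVMSbdy M ΓD a γ) :=
    ((aB.mul_const γ).mono (hle hΓp)).isBilin (iB.mono (hle hΓp))
  exact ((hA.add hDiff).add hV).add hVb

theorem isLin_rhs (hd : 1 ≤ d) (hW : IsFESpace M W) {ΓD : Set (Space d)} (hΓD : ΓD ⊆ M.boundary)
    (a : Space d) (κ β τ γ : ℝ) {f gN φD : Space d → ℝ}
    (hf : MemLp f 2 (volume.restrict M.domain))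
    (hgN : MemLp gN 2 ((surface d).restrict (M.boundary \ ΓD)))
    (hφD : MemLp φD 2 ((surface d).restrict ΓD)) : IsLin W (rhs M ΓD a κ β τ γ f gN φD) := by
  have hfin := M.isFiniteMeasure_boundary hd
  have hle : ∀ {Γ}, Γ ⊆ M.boundary → (surface d).restrict Γ ≤ (surface d).restrict M.boundary :=
    fun h => Measure.restrict_mono h le_rfl
  have hfin' : ∀ {Γ}, Γ ⊆ M.boundary → IsFiniteMeasure ((surface d).restrict Γ) :=
    fun h => isFiniteMeasure_of_le _ (hle h)
  have hΓp := (outflow_subset M a ΓD).trans hΓD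
  have hΓm := (inflow_subset M a ΓD).trans hΓD
  have hΓN : M.boundary \ ΓD ⊆ M.boundary := Set.sdiff_subset
  have := hfin' hΓD
  have := hfin' hΓp
  have := hfin' hΓm
  have := hfin' hΓN
  have rD := M.ae_regular_domain
  have rB := M.ae_regular_boundary hd
  have iD := hW.isLinearAE_id rD
  have iB := hW.isLinearAE_id rB
  have aD := hW.isLinearAE_inner_grad rD a
  have aB := hW.isLinearAE_inner_grad rB a
  have nB := hW.isLinearAE_normalDeriv hd
  have hφp := hφD.mono_measure (Measure.restrict_mono (outflow_subset M a ΓD) le_rfl)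
  have hφm := hφD.mono_measure (Measure.restrict_mono (inflow_subset M a ΓD) le_rfl)
  exact ((((((iD.isLin hf).add ((iB.mono (hle hΓN)).isLin hgN)).sub
    (((iB.mul_left (memLp_top_normalComp M hd a)).mono (hle hΓm)).isLin hφm)).sub
    (((nB.const_mul κ).mono (hle hΓD)).isLin hφD)).add
    (((iB.mul_const (κ * β)).mono (hle hΓD)).isLin hφD)).add
    ((aD.mul_const τ).isLin hf)).add
    (((aB.mul_const γ).mono (hle hΓp)).isLin hφp)

end

/-! ### Elementary inequalities -/

/-- Young's inequality in a form where the weights are fixed by how a given product is split into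
`y` and `z`. -/
theorem two_mul_abs_le {x y z : ℝ} (hy : 0 ≤ y) (hz : 0 ≤ z) (h : x ^ 2 ≤ y * z) :
    2 * |x| ≤ y + z := by
  have h1 : (2 * |x|) ^ 2 ≤ (y + z) ^ 2 := by
    rw [mul_pow, sq_abs]; nlinarith [sq_nonneg (y - z)]
  exact (sq_le_sq₀ (by positivity) (by positivity)).1 h1

/-- The Cauchy–Schwarz inequality for bounded functions on a finite measure space. -/
theorem sq_integral_mul_le {X : Type*} [MeasurableSpace X] {m : Measure X} [IsFiniteMeasure m]
    {f g : X → ℝ} (hf : MemLp f ∞ m) (hg : MemLp g ∞ m) :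
    (∫ x, f x * g x ∂m) ^ 2 ≤ (∫ x, f x ^ 2 ∂m) * ∫ x, g x ^ 2 ∂m := by
  have hf2 := (memLp_two_of_top hf).integrable_sq
  have hg2 := (memLp_two_of_top hg).integrable_sq
  have hfg : Integrable (fun x => f x * g x) m := (hg.mul (r := ∞) hf).integrable (by simp)
  have h : ∀ t : ℝ, 0 ≤ (∫ x, f x ^ 2 ∂m) * (t * t) + (2 * ∫ x, f x * g x ∂m) * t
      + ∫ x, g x ^ 2 ∂m := by
    intro t
    have h1 : 0 ≤ ∫ x, (t * f x + g x) ^ 2 ∂m := integral_nonneg fun x => sq_nonneg _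
    have hs : Integrable (fun x => t * t * f x ^ 2 + 2 * t * (f x * g x)) m :=
      (hf2.const_mul _).add (hfg.const_mul _)
    have h2 : ∫ x, (t * f x + g x) ^ 2 ∂m = (t * t) * (∫ x, f x ^ 2 ∂m)
        + (2 * t) * (∫ x, f x * g x ∂m) + ∫ x, g x ^ 2 ∂m := by
      rw [← integral_const_mul, ← integral_const_mul, ← integral_add (hf2.const_mul _)
        (hfg.const_mul _), ← integral_add hs hg2]
      congr 1
      ext x
      ring
    rw [h2] at h1
    linarith
  have := discrim_le_zero h
  rw [discrim] at this
  nlinarith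

/-! ### The stabilization parameters -/

theorem tauEff_pos (P : Degree) (τ₁a : ℝ≥0∞) {τ₁d : ℝ} (h : 0 < τ₁d) : 0 < tauEff P τ₁a τ₁d := by
  cases P <;> simp only [tauEff] <;> positivity

theorem sqrt_one_div_le {x y : ℝ} (hy : 0 < y) (h : (1 / y) ^ 2 ≤ x) : √(1 / x) ≤ y := by
  have h0 : 0 < (1 / y) ^ 2 := by positivity
  rw [Real.sqrt_le_left hy.le, one_div_le (h0.trans_le h) (by positivity), one_div,
    ← inv_pow, ← one_div]
  exact h

/-- Dropping the advective term under the root leaves exactly the right-hand side. -/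
theorem tauEff_le (P : Degree) (τ₁a : ℝ≥0∞) {τ₁d : ℝ} (h : 0 < τ₁d) :
    tauEff P τ₁a τ₁d ≤ Cd P * τ₁d := by
  cases P <;> simp only [tauEff, Cd] <;> refine sqrt_one_div_le (by positivity) ?_
  · rw [one_div, one_mul]
    nlinarith [sq_nonneg (τ₁a⁻¹).toReal]
  · rw [one_div, mul_inv, mul_pow]
    nlinarith [sq_nonneg (τ₁a⁻¹).toReal]
  · rw [one_div, mul_inv, mul_pow]
    nlinarith [sq_nonneg (τ₁a⁻¹).toReal]

theorem div_le_mul_sqrt {κ u v : ℝ} (hκ : 0 < κ) (hu : 0 < u) (hv : 0 < v)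
    (h : v ≤ (3 * u) ^ 2) : κ / u ≤ 3 * κ * √(1 / v) := by
  have h1 : √v ≤ 3 * u := (Real.sqrt_le_left (by positivity)).2 h
  have h2 : 0 < √v := Real.sqrt_pos.2 hv
  rw [Real.sqrt_div zero_le_one, Real.sqrt_one, mul_one_div, div_le_div_iff₀ hu h2]
  nlinarith

/-- This ties the boundary parameter to the volumetric one, so that the boundary stabilization can
be absorbed by `τ ‖a·∇w‖²` and the penalty. The factor 3 is attained for linear elements without
advection. -/
theorem gammaEff_sq_le (P : Degree) (cs : ℝ) {κ : ℝ} (hκ : 0 < κ) (τ₁a : ℝ≥0∞) {τ₁d : ℝ}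
    (h : 0 < τ₁d) :
    gammaEff P cs κ τ₁a τ₁d ^ 2 ≤ 3 * cs ^ 2 * κ * tauEff P τ₁a τ₁d := by
  set A := (τ₁a⁻¹).toReal with hA
  have hA0 : 0 ≤ A := ENNReal.toReal_nonneg
  obtain ⟨D, hD, rfl⟩ : ∃ D : ℝ, 0 < D ∧ τ₁d = D⁻¹ := ⟨τ₁d⁻¹, by positivity, by simp⟩
  have key : ∀ {u v : ℝ}, 0 < u → 0 < v → v ≤ (3 * u) ^ 2 →
      (cs * √(κ / u)) ^ 2 ≤ 3 * cs ^ 2 * κ * √(1 / v) := by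
    intro u v hu hv huv
    rw [mul_pow, Real.sq_sqrt (by positivity)]
    nlinarith [div_le_mul_sqrt hκ hu hv huv, sq_nonneg cs]
  -- With `D = 1 / τ₁d` and `A² = D r`, the three cases become inequalities between quadratic
  -- polynomials in `r, D ≥ 0` that hold coefficient by coefficient.
  set r := D⁻¹ * A ^ 2 with hr
  have hr0 : 0 ≤ r := by positivity
  have hDr : D * r = A ^ 2 := by rw [hr]; field_simp
  cases P <;> simp only [gammaEff, tauEff, ← hA, inv_inv, mul_assoc _ (D⁻¹) (A ^ 2), ← hr] <;>
    refine key (by positivity) (by positivity) ?_ <;> nlinarith [mul_nonneg hD.le hr0, sq_nonneg r]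

/-! ### The advective energy -/

section

variable {M : Mesh d} {W : Submodule ℝ (Space d → ℝ)}

open Mesh

/-- The divergence theorem is applied to `w²`, whose gradient is `2 w ∇w`. -/
theorem Mesh.IsPieces.integral_inner_grad_mul (hd : 1 ≤ d) {w : Space d → ℝ}
    {v : M.ι → Space d → ℝ} (h : M.IsPieces w v) (a : Space d) :
    ∫ x in M.domain, inner ℝ a (M.grad w x) * w x =
      1 / 2 * ∫ x in M.boundary, M.normalComp a x * w x ^ 2 ∂(surface d) := by
  have hsq : M.IsPieces (fun x => w x ^ 2) fun i x => v i x ^ 2 := fun i =>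
    ⟨(h i).1.pow 2, fun x hx => by simp only [(h i).2 hx]⟩
  rw [← hsq.integral_inner_grad hd a, ← integral_const_mul]
  refine integral_congr_ae ?_
  filter_upwards [M.ae_regular_domain] with x ⟨i, hi⟩
  rw [hsq.grad_eq hi, h.grad_eq hi, real_inner_comm, inner_gradient_left,
    real_inner_comm _ a, inner_gradient_left, fderiv_fun_pow 2 (h.differentiable i x), (h i).2 hi.mem]
  simp
  ring

theorem nullMeasurableSet_outflow (M : Mesh d) (hd : 1 ≤ d) (a : Space d) :
    NullMeasurableSet {x | 0 ≤ M.normalComp a x} ((surface d).restrict M.boundary) :=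
  (memLp_top_normalComp M hd a).1.aemeasurable.nullMeasurable measurableSet_Ici

theorem integral_outflow_boundary (M : Mesh d) (hd : 1 ≤ d) (a : Space d) (f : Space d → ℝ) :
    ∫ x in M.outflow a M.boundary, f x ∂(surface d) =
      ∫ x in M.boundary, {x | 0 ≤ M.normalComp a x}.indicator f x ∂(surface d) := by
  have h := nullMeasurableSet_outflow M hd a
  rw [integral_indicator₀ h, Measure.restrict_restrict₀ h]
  have hset : M.outflow a M.boundary = {x | 0 ≤ M.normalComp a x} ∩ M.boundary := by
    ext x
    simp only [outflow, Set.mem_inter_iff, Set.mem_ofPred_eq]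
    tauto
  rw [hset]

/-- Integration by parts leaves `-(a·n)/2` on the whole boundary and the outflow term adds `a·n`
where it is non-negative; on both parts the result is `|a·n|/2`. -/
theorem BA_self (hd : 1 ≤ d) (hW : IsFESpace M W) (a : Space d) {w : Space d → ℝ} (hw : w ∈ W) :
    BA M a w w = 1 / 2 * surfSq M.boundary fun x => √|M.normalComp a x| * w x := by
  have hfin := M.isFiniteMeasure_boundary hd
  obtain ⟨v, hv⟩ := hW.exists_pieces hw
  have hwB := hv.memLp_top (M.ae_regular_boundary hd)
  have hN := memLp_top_normalComp M hd a
  have hi : Integrable (fun x => M.normalComp a x * w x ^ 2) ((surface d).restrict M.boundary) := by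
    simp only [pow_two]
    exact ((hwB.mul (r := ∞) hwB).mul (r := ∞) hN).integrable (by simp)
  rw [BA, hv.integral_inner_grad_mul hd a, integral_outflow_boundary M hd, surfSq,
    ← integral_const_mul, ← integral_const_mul, ← integral_neg, ← integral_add]
  · refine integral_congr_ae (Filter.Eventually.of_forall fun x => ?_)
    simp only [mul_pow, Real.sq_sqrt (abs_nonneg _)]
    by_cases hx : 0 ≤ M.normalComp a x
    · rw [Set.indicator_of_mem (show x ∈ {x | 0 ≤ M.normalComp a x} from hx), abs_of_nonneg hx]
      ring
    · rw [Set.indicator_of_notMem (show x ∉ {x | 0 ≤ M.normalComp a x} from hx),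
        abs_of_neg (not_le.1 hx)]
      ring
  · exact (hi.const_mul _).neg
  · refine Integrable.indicator₀ ?_ (nullMeasurableSet_outflow M hd a)
    simpa only [pow_two, mul_assoc] using hi

/-! ### Functions with vanishing norms -/

/-- A piecewise continuous function with zero `L²` norm vanishes on every closed element. -/
theorem Mesh.eq_zero_of_integral_sq_eq_zero {f : Space d → ℝ} {g : M.ι → Space d → ℝ}
    (hg : ∀ i, Continuous (g i)) (hfg : ∀ i, ∀ x ∈ interior (M.cell i), f x = g i x)
    (h0 : ∫ x in M.domain, f x ^ 2 = 0) (i : M.ι) {x : Space d} (hx : x ∈ M.cell i) :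
    g i x = 0 := by
  have hf : MemLp f ∞ (volume.restrict M.domain) := Mesh.memLp_top_of_pieces hg <| by
    filter_upwards [M.ae_interior] with x ⟨i, hi⟩
      using ⟨i, Mesh.isRegular_of_mem_interior hi, hfg i x hi⟩
  rw [integral_eq_zero_iff_of_nonneg (fun x => sq_nonneg _) (memLp_two_of_top hf).integrable_sq]
    at h0
  have h1 : g i =ᵐ[volume.restrict (interior (M.cell i))] fun _ => 0 := by
    filter_upwards [ae_mono (Measure.restrict_mono (M.interior_cell_subset_domain i) le_rfl) h0,
      ae_restrict_mem isOpen_interior.measurableSet] with y hy hyi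
    rw [← hfg i y hyi]
    simpa using hy
  have h2 := Measure.eqOn_open_of_ae_eq h1 isOpen_interior (hg i).continuousOn continuousOn_const
  have h3 := h2.closure (hg i) continuous_const
  rw [M.closure_interior_cell] at h3
  exact h3 hx

theorem Mesh.IsPieces.gradient_eq_zero {w : Space d → ℝ} {v : M.ι → Space d → ℝ}
    (h : M.IsPieces w v) (hG : gradSq M w = 0) (i : M.ι) {x : Space d} (hx : x ∈ M.cell i) :
    gradient (v i) x = 0 := by
  rw [← norm_eq_zero]
  exact Mesh.eq_zero_of_integral_sq_eq_zero (f := fun x => ‖M.grad w x‖)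
    (g := fun i x => ‖gradient (v i) x‖) (fun i => (continuous_gradient (h i).1).norm)
    (fun i x hx => by rw [h.grad_eq (isRegular_of_mem_interior hx)]) hG i hx

/-! ### Trace and inverse estimates as real inequalities -/

theorem surfSq_nonneg (Γ : Set (Space d)) (f : Space d → ℝ) : 0 ≤ surfSq Γ f :=
  integral_nonneg fun _ => sq_nonneg _

theorem volSq_nonneg (Γ : Set (Space d)) (f : Space d → ℝ) : 0 ≤ volSq Γ f :=
  integral_nonneg fun _ => sq_nonneg _

theorem gradSq_nonneg (M : Mesh d) (w : Space d → ℝ) : 0 ≤ gradSq M w :=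
  integral_nonneg fun _ => sq_nonneg _

theorem surfSq_eq_zero {Γ : Set (Space d)} {f : Space d → ℝ}
    (h : ∀ᵐ x ∂((surface d).restrict Γ), f x = 0) : surfSq Γ f = 0 := by
  rw [surfSq, integral_eq_zero_of_ae]
  filter_upwards [h] with x hx
  simp [hx]

/-- A quotient bound in `[0, ∞]`, read as an inequality of real numbers. -/
theorem le_toReal_mul {x y : ℝ} {T : ℝ≥0∞} (hT : T ≠ ∞) (hy : 0 ≤ y)
    (h : y ≠ 0 → ENNReal.ofReal (x / y) ≤ T) (h0 : y = 0 → x = 0) : x ≤ T.toReal * y := by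
  by_cases hy0 : y = 0
  · rw [hy0, h0 hy0, mul_zero]
  · have h1 := (ENNReal.ofReal_le_iff_le_toReal hT).1 (h hy0)
    rwa [div_le_iff₀ (lt_of_le_of_ne hy (Ne.symm hy0))] at h1

theorem ae_regular_of_subset (hd : 1 ≤ d) {Γ : Set (Space d)} (hΓ : Γ ⊆ M.boundary) :
    ∀ᵐ x ∂((surface d).restrict Γ), ∃ i : M.ι, IsRegular i x :=
  ae_mono (Measure.restrict_mono hΓ le_rfl) (M.ae_regular_boundary hd)

/-- The supremum says nothing when the gradient norm is zero. In that case continuity of the pieces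
up to the closed elements makes the boundary trace vanish too. -/
theorem surfSq_normalDeriv_le (hd : 1 ≤ d) (hW : IsFESpace M W) {ΓD : Set (Space d)}
    (hΓD : ΓD ⊆ M.boundary) (hT : T₁ M ΓD W ≠ ∞) {w : Space d → ℝ} (hw : w ∈ W) :
    surfSq ΓD (M.normalDeriv w) ≤ (T₁ M ΓD W).toReal * gradSq M w := by
  refine le_toReal_mul hT (gradSq_nonneg M w) (fun h => ?_) fun h => ?_
  · exact le_iSup_of_le w (le_iSup_of_le hw (le_iSup_of_le h le_rfl))
  · obtain ⟨v, hv⟩ := hW.exists_pieces hw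
    refine surfSq_eq_zero ?_
    filter_upwards [ae_regular_of_subset hd hΓD] with x ⟨i, hi⟩
    rw [normalDeriv, hv.grad_eq hi, hv.gradient_eq_zero h i hi.mem, inner_zero_right]

theorem surfSq_outflow_le (hd : 1 ≤ d) (hW : IsFESpace M W) {ΓD : Set (Space d)}
    (hΓD : ΓD ⊆ M.boundary) (a : Space d) (hT : T₂ M ΓD a W ≠ ∞) {w : Space d → ℝ} (hw : w ∈ W) :
    surfSq (M.outflow a ΓD) (fun x => inner ℝ a (M.grad w x)) ≤
      (T₂ M ΓD a W).toReal * volSq M.domain (fun x => inner ℝ a (M.grad w x)) := by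
  refine le_toReal_mul hT (volSq_nonneg _ _) (fun h => ?_) fun h => ?_
  · exact le_iSup_of_le w (le_iSup_of_le hw (le_iSup_of_le h le_rfl))
  · obtain ⟨v, hv⟩ := hW.exists_pieces hw
    refine surfSq_eq_zero ?_
    filter_upwards [ae_regular_of_subset hd ((outflow_subset M a ΓD).trans hΓD)] with x ⟨i, hi⟩
    rw [hv.grad_eq hi]
    exact Mesh.eq_zero_of_integral_sq_eq_zero (f := fun x => inner ℝ a (M.grad w x))
      (g := fun i x => inner ℝ a (gradient (v i) x))
      (fun i => continuous_const.inner (continuous_gradient (hv i).1))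
      (fun i x hx => by rw [hv.grad_eq (isRegular_of_mem_interior hx)]) h i hi.mem

theorem laplacian_le_of_tauBound {κ τ : ℝ} (hκ : 0 < κ) {c : ℝ} (hτ : τ ≤ c)
    (h : ENNReal.ofReal c ≤ tauBound M κ W) {w : Space d → ℝ} (hw : w ∈ W) :
    2 * κ * τ * volSq M.openCells (Laplacian.laplacian w) ≤ gradSq M w := by
  set L := volSq M.openCells (Laplacian.laplacian w) with hL
  have hL0 : 0 ≤ L := volSq_nonneg _ _
  have hG := gradSq_nonneg M w
  by_cases h0 : L = 0
  · rw [h0, mul_zero]; exact hG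
  · have h1 : tauBound M κ W ≤ ENNReal.ofReal (1 / (2 * κ) * (gradSq M w / L)) :=
      iInf_le_of_le w (iInf_le_of_le hw (iInf_le_of_le h0 le_rfl))
    have h2 := (ENNReal.ofReal_le_ofReal_iff (by positivity)).1 (h.trans h1)
    have hLpos : 0 < L := lt_of_le_of_ne hL0 (Ne.symm h0)
    have h3 := hτ.trans h2
    rw [div_mul_div_comm, one_mul, le_div_iff₀ (by positivity)] at h3
    linarith

end

section

variable {M : Mesh d} {W : Submodule ℝ (Space d → ℝ)}

open Mesh

/-! ### Coercivity -/

/-- The algebraic core of the coercivity estimate, in terms of the norms `A = ‖a ⬝ ∇w‖²`,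
`G = ‖∇w‖²`, `L = ‖Δw‖²`, `S = ‖w‖²_{∂Ω_D}` and of the mixed products. -/
theorem coercivity_algebra {A G L S X Y Z T₁ T₂ cs κ β τ γ : ℝ} (hκ : 0 < κ) (hτ : 0 < τ)
    (hA : 0 ≤ A) (hG : 0 ≤ G) (hL : 0 ≤ L) (hS : 0 ≤ S) (hT₁ : 0 ≤ T₁) (hT₂ : 0 ≤ T₂)
    (hX : X ^ 2 ≤ S * (T₁ * G)) (hY : Y ^ 2 ≤ A * L) (hZ : Z ^ 2 ≤ T₂ * A * S)
    (hLG : 2 * κ * τ * L ≤ G) (hγ : γ ^ 2 ≤ 3 * cs ^ 2 * κ * τ)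
    (hβ : 4 * (T₁ + cs ^ 2 * T₂) ≤ β) :
    1 / 4 * τ * A + 1 / 4 * κ * G + 1 / 4 * β * κ * S ≤
      κ * G - κ * X - κ * X + κ * β * S + (τ * A - τ * κ * Y) + γ * Z := by
  -- The splittings are chosen to fit the budget. Of `κ G`, a half goes to the Nitsche terms and a
  -- quarter to the Laplacian; of `τ A`, a half goes to the Laplacian and a quarter to `γ Z`. The
  -- boundary cost `κ (2 T₁ + 3 cs² T₂) S` is at most three quarters of the penalty.
  have h1 : 2 * |X| ≤ 1 / 2 * G + 2 * T₁ * S :=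
    two_mul_abs_le (by positivity) (by positivity) (hX.trans (le_of_eq (by ring)))
  have h2 : 2 * |κ * Y| ≤ A + κ ^ 2 * L := by
    refine two_mul_abs_le hA (by positivity) ?_
    rw [mul_pow]
    nlinarith [mul_le_mul_of_nonneg_left hY (sq_nonneg κ)]
  have h3 : 2 * |γ * Z| ≤ 1 / 2 * τ * A + 6 * cs ^ 2 * κ * T₂ * S := by
    refine two_mul_abs_le (by positivity) (by positivity) ?_
    rw [mul_pow]
    calc γ ^ 2 * Z ^ 2 ≤ (3 * cs ^ 2 * κ * τ) * (T₂ * A * S) :=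
          mul_le_mul hγ hZ (sq_nonneg _) (by positivity)
      _ = _ := by ring
  have h4 : κ * (2 * X) ≤ κ * (1 / 2 * G + 2 * T₁ * S) :=
    mul_le_mul_of_nonneg_left (by linarith [le_abs_self X]) hκ.le
  have h5 : τ * (2 * (κ * Y)) ≤ τ * (A + κ ^ 2 * L) :=
    mul_le_mul_of_nonneg_left (by linarith [le_abs_self (κ * Y)]) hτ.le
  have h6 := neg_abs_le (γ * Z)
  have h7 : κ * (2 * κ * τ * L) ≤ κ * G := mul_le_mul_of_nonneg_left hLG hκ.le
  have h8 : κ * S * (2 * T₁ + 3 * cs ^ 2 * T₂) ≤ κ * S * (3 / 4 * β) :=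
    mul_le_mul_of_nonneg_left (by linarith) (by positivity)
  nlinarith

theorem volSq_domain_eq (M : Mesh d) (f : Space d → ℝ) :
    volSq M.openCells f = volSq M.domain f := setIntegral_congr_set M.domain_ae_eq_openCells

/-- Coercivity in terms of real bounds for the trace and inverse estimates. -/
theorem coercive (hd : 1 ≤ d) (hW : IsFESpace M W) {ΓD : Set (Space d)} (hΓD : ΓD ⊆ M.boundary)
    (a : Space d) {κ β τ γ cs : ℝ} (hκ : 0 < κ) (hτ : 0 < τ)
    (hγ : γ ^ 2 ≤ 3 * cs ^ 2 * κ * τ) (hT₁ : T₁ M ΓD W ≠ ∞) (hT₂ : T₂ M ΓD a W ≠ ∞)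
    (hβ : 4 * ((T₁ M ΓD W).toReal + cs ^ 2 * (T₂ M ΓD a W).toReal) ≤ β)
    {w : Space d → ℝ} (hw : w ∈ W)
    (hL : 2 * κ * τ * volSq M.openCells (Laplacian.laplacian w) ≤ gradSq M w) :
    1 / 4 * τ * volSq M.domain (fun x => inner ℝ a (M.grad w x))
      + 1 / 2 * surfSq M.boundary (fun x => √|M.normalComp a x| * w x)
      + 1 / 4 * κ * gradSq M w + 1 / 4 * β * κ * surfSq ΓD w ≤ B M ΓD a κ β τ γ w w := by
  have hfin := M.isFiniteMeasure_boundary hd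
  have hle : ∀ {Γ}, Γ ⊆ M.boundary → (surface d).restrict Γ ≤ (surface d).restrict M.boundary :=
    fun h => Measure.restrict_mono h le_rfl
  have hfin' : ∀ {Γ}, Γ ⊆ M.boundary → IsFiniteMeasure ((surface d).restrict Γ) :=
    fun h => isFiniteMeasure_of_le _ (hle h)
  have hΓp := (outflow_subset M a ΓD).trans hΓD
  have := hfin' hΓD
  have := hfin' hΓp
  have rB := M.ae_regular_boundary hd
  have wB := (hW.isLinearAE_id rB).memLp w hw
  have aD := (hW.isLinearAE_inner_grad M.ae_regular_domain a).memLp w hw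
  have aB := (hW.isLinearAE_inner_grad rB a).memLp w hw
  have nB := (hW.isLinearAE_normalDeriv hd).memLp w hw
  have lD := hW.isLinearAE_laplacian.memLp w hw
  have hX := sq_integral_mul_le (wB.mono_measure (hle hΓD)) (nB.mono_measure (hle hΓD))
  have hY := sq_integral_mul_le aD lD
  have hZ := sq_integral_mul_le (aB.mono_measure (hle hΓp)) (wB.mono_measure (hle hΓp))
  have hS : surfSq (M.outflow a ΓD) w ≤ surfSq ΓD w :=
    setIntegral_mono_set (memLp_two_of_top (wB.mono_measure (hle hΓD))).integrable_sq
      (Filter.Eventually.of_forall fun _ => sq_nonneg _)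
      (outflow_subset M a ΓD).eventuallyLE
  have hN := surfSq_normalDeriv_le hd hW hΓD hT₁ hw
  have hO := surfSq_outflow_le hd hW hΓD a hT₂ hw
  have hX' := hX.trans (mul_le_mul_of_nonneg_left hN (surfSq_nonneg ΓD w))
  have hZ' := hZ.trans (mul_le_mul hO hS (surfSq_nonneg _ w)
    (mul_nonneg ENNReal.toReal_nonneg (volSq_nonneg _ _)))
  have hG : ∫ x in M.domain, κ * inner ℝ (M.grad w x) (M.grad w x) = κ * gradSq M w := by
    rw [integral_const_mul, gradSq]
    simp only [real_inner_self_eq_norm_sq]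
  have hD : BD M ΓD κ β w w = κ * gradSq M w
      - κ * (∫ x in ΓD, w x * M.normalDeriv w x ∂(surface d))
      - κ * (∫ x in ΓD, w x * M.normalDeriv w x ∂(surface d)) + κ * β * surfSq ΓD w := by
    rw [BD, hG, surfSq]
    simp only [← integral_const_mul]
    refine congrArg₂ (· + ·) (congrArg₂ (· - ·) (congrArg₂ (· - ·) rfl ?_) ?_) ?_ <;>
      (congr 1; ext x; ring)
  have hV : BVMSvol M a κ τ w w = τ * volSq M.domain (fun x => inner ℝ a (M.grad w x))
      - τ * κ * ∫ x in M.domain, inner ℝ a (M.grad w x) * Laplacian.laplacian w x := by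
    rw [BVMSvol, setIntegral_congr_set M.domain_ae_eq_openCells, volSq, ← integral_const_mul,
      ← integral_const_mul, ← integral_sub]
    · congr 1; ext x; ring
    · exact (memLp_two_of_top aD).integrable_sq.const_mul _
    · exact ((lD.mul (r := ∞) aD).integrable (by simp)).const_mul _
  have hVb : BVMSbdy M ΓD a γ w w =
      γ * ∫ x in M.outflow a ΓD, inner ℝ a (M.grad w x) * w x ∂(surface d) := by
    rw [BVMSbdy, ← integral_const_mul]
    congr 1; ext x; ring
  have key := coercivity_algebra hκ hτ (volSq_nonneg _ _) (gradSq_nonneg M w)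
    (volSq_nonneg M.domain (Laplacian.laplacian w)) (surfSq_nonneg ΓD w)
    ENNReal.toReal_nonneg ENNReal.toReal_nonneg hX' hY hZ'
    (by rwa [volSq_domain_eq] at hL) hγ hβ
  rw [B, BA_self hd hW a hw, hD, hV, hVb]
  linarith

/-! ### Definiteness -/

/-- On each convex element `w` is constant. Near a point `x` of the domain only elements containing
`x` occur, so `w` is locally constant across shared faces, and connectedness makes it constant. -/
theorem exists_const_of_gradSq_eq_zero (hW : IsFESpace M W) {w : Space d → ℝ} (hw : w ∈ W)
    (hG : gradSq M w = 0) : ∃ c, ∀ x ∈ closure M.domain, w x = c := by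
  obtain ⟨v, hv⟩ := hW.exists_pieces hw
  have hcell : ∀ i, ∀ x ∈ M.cell i, ∀ y ∈ M.cell i, w x = w y := by
    intro i x hx y hy
    have hfd : ∀ z ∈ M.cell i, fderivWithin ℝ (v i) (M.cell i) z = 0 := by
      intro z hz
      rw [(hv.differentiable i z).fderivWithin (M.uniqueDiffOn_cell i z hz)]
      ext u
      rw [← inner_gradient_left, hv.gradient_eq_zero hG i hz, inner_zero_left]
      simp
    rw [(hv i).2 hx, (hv i).2 hy]
    exact (M.convex_cell i).is_const_of_fderivWithin_eq_zero
      (hv.differentiable i).differentiableOn hfd hx hy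
  have hloc : ∀ x ∈ M.domain, w =ᶠ[𝓝 x] fun _ => w x := by
    intro x hx
    have hnear : ∀ᶠ y in 𝓝 x, ∀ j, y ∈ M.cell j → x ∈ M.cell j := by
      rw [Filter.eventually_all]
      intro j
      by_cases hj : x ∈ M.cell j
      · simp [hj]
      · filter_upwards [(M.isClosed_cell j).isOpen_compl.mem_nhds hj] with y hy h
          using absurd h hy
    filter_upwards [hnear, M.isOpen_domain.mem_nhds hx] with y hy hyd
    obtain ⟨j, hj⟩ := Set.mem_iUnion.1 (interior_subset hyd)
    exact hcell j y hj x (hy j hj)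
  obtain ⟨c, hc⟩ := M.isOpen_domain.exists_is_const_of_fderiv_eq_zero (𝕜 := ℝ) (f := w)
    M.connected.isPreconnected
    (fun x hx => ((differentiableAt_const (w x)).congr_of_eventuallyEq
      (hloc x hx)).differentiableWithinAt)
    (fun x hx => by rw [(hloc x hx).fderiv_eq]; simp)
  refine ⟨c, fun x hx => ?_⟩
  rw [M.closure_domain] at hx
  obtain ⟨i, hi⟩ := Set.mem_iUnion.1 hx
  obtain ⟨y, hy⟩ := M.nonempty_interior i
  rw [hcell i x hi y (interior_subset hy), hc y (M.interior_cell_subset_domain i hy)]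

/-- A non-zero constant field has a non-zero flux density somewhere on the boundary. -/
theorem integral_abs_normalComp_ne_zero (hd : 1 ≤ d) (M : Mesh d) {a : Space d} (ha : a ≠ 0) :
    ∫ x in M.boundary, |M.normalComp a x| ∂(surface d) ≠ 0 := by
  intro h0
  have hfin := M.isFiniteMeasure_boundary hd
  have hN := memLp_top_normalComp M hd a
  rw [integral_eq_zero_iff_of_nonneg (fun x => abs_nonneg _) (hN.integrable (by simp)).abs] at h0
  -- The divergence theorem is tested with `x ↦ a·x`, for which the volume side is `‖a‖²` times the
  -- positive finite volume of the domain.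
  have hp : M.IsPieces (fun x => inner ℝ a x) fun _ x => inner ℝ a x := fun i =>
    ⟨(innerSL ℝ a).contDiff, fun _ _ => rfl⟩
  have hdiv := hp.integral_inner_grad hd a
  have hR : ∫ x in M.boundary, M.normalComp a x * inner ℝ a x ∂(surface d) = 0 := by
    refine integral_eq_zero_of_ae ?_
    filter_upwards [h0] with x hx
    simp [abs_eq_zero.1 hx]
  have hL : ∫ x in M.domain, inner ℝ a (M.grad (fun x => inner ℝ a x) x) =
      ∫ _ in M.domain, ‖a‖ ^ 2 := by
    refine integral_congr_ae ?_
    filter_upwards [M.ae_regular_domain] with x ⟨i, hi⟩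
    have hf : fderiv ℝ (fun x : Space d => (inner ℝ a x : ℝ)) x = innerSL ℝ a :=
      (innerSL ℝ a).fderiv
    rw [hp.grad_eq hi, real_inner_comm, inner_gradient_left, hf, innerSL_apply_apply,
      real_inner_self_eq_norm_sq]
  rw [hL, hR, setIntegral_const, smul_eq_mul, mul_eq_zero] at hdiv
  rcases hdiv with h | h
  · rw [Measure.real, ENNReal.toReal_eq_zero_iff] at h
    rcases h with h | h
    · exact (M.isOpen_domain.measure_pos volume M.connected.nonempty).ne' h
    · exact M.volume_domain_lt_top.ne h
  · exact ha (by simpa using h)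

theorem eq_zero_of_norms_eq_zero (hd : 1 ≤ d) (hW : IsFESpace M W) {ΓD : Set (Space d)}
    (hΓD : ΓD ⊆ M.boundary) (hΓDm : MeasurableSet ΓD) {a : Space d} {w : Space d → ℝ} (hw : w ∈ W)
    (hG : gradSq M w = 0)
    (h : (a ≠ 0 ∧ surfSq M.boundary (fun x => √|M.normalComp a x| * w x) = 0) ∨
      (surface d ΓD ≠ 0 ∧ surfSq ΓD w = 0)) : w = 0 := by
  obtain ⟨c, hc⟩ := exists_const_of_gradSq_eq_zero hW hw hG
  have hcb : ∀ x ∈ M.boundary, w x = c := fun x hx => hc x (frontier_subset_closure hx)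
  have hc0 : c = 0 := by
    rw [← sq_eq_zero_iff]
    rcases h with ⟨ha, h⟩ | ⟨hΓ, h⟩
    · have h1 : surfSq M.boundary (fun x => √|M.normalComp a x| * w x) =
          (∫ x in M.boundary, |M.normalComp a x| ∂(surface d)) * c ^ 2 := by
        rw [surfSq, ← integral_mul_const]
        refine setIntegral_congr_fun M.isClosed_boundary.measurableSet fun x hx => ?_
        simp only [mul_pow, Real.sq_sqrt (abs_nonneg _), hcb x hx]
      rw [h1, mul_eq_zero] at h
      exact h.resolve_left (integral_abs_normalComp_ne_zero hd M ha)
    · have h1 : surfSq ΓD w = (surface d).real ΓD * c ^ 2 := by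
        rw [surfSq, ← smul_eq_mul, ← setIntegral_const]
        exact setIntegral_congr_fun hΓDm fun x hx => by simp only [hcb x (hΓD hx)]
      rw [h1, mul_eq_zero, Measure.real, ENNReal.toReal_eq_zero_iff] at h
      refine h.resolve_left fun h => h.elim hΓ ?_
      exact ((measure_mono hΓD).trans_lt (surface_boundary_lt_top hd)).ne
  funext x
  by_cases hx : x ∈ closure M.domain
  · rw [hc x hx, hc0]; rfl
  · exact hW.extended_by_zero w hw x hx

/-! ### Solvability -/

/-- A definite bilinear form on a finite-dimensional space represents every functional. -/
theorem existsUnique_of_definite (hfd : FiniteDimensional ℝ W)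
    {T : (Space d → ℝ) → (Space d → ℝ) → ℝ} {F : (Space d → ℝ) → ℝ} (hT : IsBilin W T)
    (hF : IsLin W F) (hdef : ∀ w ∈ W, T w w = 0 → w = 0) :
    ∃! φ : Space d → ℝ, φ ∈ W ∧ ∀ w ∈ W, T w φ = F w := by
  obtain ⟨b, hb⟩ := hT
  obtain ⟨l, hl⟩ := hF
  -- The unknown sits in the second slot and the test function in the first, hence the flip;
  -- surjectivity then follows from equal dimensions of the space and its dual.
  have hinj : Function.Injective b.flip := by
    rw [injective_iff_map_eq_zero]
    intro φ hφ
    have h0 : b φ φ = 0 := by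
      rw [← LinearMap.flip_apply, hφ, LinearMap.zero_apply]
    rw [hb] at h0
    exact Subtype.ext (hdef φ φ.2 h0)
  have hsurj : Function.Surjective b.flip :=
    (LinearMap.injective_iff_surjective_of_finrank_eq_finrank
      (Subspace.dual_finrank_eq (K := ℝ) (V := W)).symm).1 hinj
  obtain ⟨φ, hφ⟩ := hsurj l
  refine ⟨φ, ⟨φ.2, fun w hw => ?_⟩, fun ψ ⟨hψ, hψl⟩ => ?_⟩
  · have := congrArg (fun k => k (⟨w, hw⟩ : W)) hφ
    simpa [hb, hl] using this
  · have h : b.flip ⟨ψ, hψ⟩ = b.flip φ := by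
      rw [hφ]
      ext w
      rw [LinearMap.flip_apply, hb, hl]
      exact hψl w w.2
    exact congrArg Subtype.val (hinj h)

/-- The penalty condition, read as an inequality of real numbers. -/
theorem penalty_toReal {T S : ℝ≥0∞} {cs β : ℝ} (hcs : 0 < cs)
    (h : ((4 * (T + ENNReal.ofReal (cs ^ 2) * S) : ℝ≥0∞) : EReal) ≤ (β : EReal)) :
    T ≠ ∞ ∧ S ≠ ∞ ∧ 4 * (T.toReal + cs ^ 2 * S.toReal) ≤ β := by
  have hne : (4 * (T + ENNReal.ofReal (cs ^ 2) * S) : ℝ≥0∞) ≠ ∞ := by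
    intro htop
    rw [htop, EReal.coe_ennreal_top, top_le_iff] at h
    exact EReal.coe_ne_top β h
  -- Positivity of `cs` matters here: with `0 * ∞ = 0`, a zero factor would hide an infinite second
  -- constant.
  have hc : ENNReal.ofReal (cs ^ 2) ≠ 0 := by
    rw [Ne, ENNReal.ofReal_eq_zero, not_le]; positivity
  have hsum : T + ENNReal.ofReal (cs ^ 2) * S ≠ ∞ := fun h =>
    hne (by rw [h]; exact ENNReal.mul_top (by norm_num))
  have hT : T ≠ ∞ := fun h => hsum (by rw [h, top_add])
  have hcS : ENNReal.ofReal (cs ^ 2) * S ≠ ∞ := fun h => hsum (by rw [h, add_top])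
  have hS : S ≠ ∞ := fun h => hcS (by rw [h]; exact ENNReal.mul_top hc)
  refine ⟨hT, hS, ?_⟩
  rw [← EReal.coe_ennreal_toReal hne, EReal.coe_le_coe_iff, ENNReal.toReal_mul,
    ENNReal.toReal_add hT hcS, ENNReal.toReal_mul, ENNReal.toReal_ofReal (sq_nonneg cs)] at h
  simpa using h

end

end VMSNitsche

end

/-! ### Coercivity and unique solvability -/

theorem mainTheorem1 {d : ℕ} (hd : 1 ≤ d) (M : Mesh d)
    (ΓD : Set (Space d)) (hΓD : ΓD ⊆ M.boundary) (hΓDm : MeasurableSet ΓD)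
    (W : Submodule ℝ (Space d → ℝ)) (hW : IsFESpace M W)
    (a : Space d) (κ β : ℝ) (hκ : 0 < κ)
    (P : Degree) (cs τ₁d : ℝ) (hcs : 0 < cs) (hτ₁d : 0 < τ₁d) (τ₁a : ℝ≥0∞) (hτ₁a : τ₁a ≠ 0)
    (τ γ : ℝ) (hτ : τ = tauEff P τ₁a τ₁d) (hγ : γ = gammaEff P cs κ τ₁a τ₁d)
    (hbound : ENNReal.ofReal (Cd P * τ₁d) ≤ tauBound M κ W)
    (hβ : ((4 * (T₁ M ΓD W + ENNReal.ofReal (cs ^ 2) * T₂ M ΓD a W) : ℝ≥0∞) : EReal)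
      ≤ (β : EReal)) :
    (∀ w ∈ W,
      B M ΓD a κ β τ γ w w ≥
        1 / 4 * τ * volSq M.domain (fun x => inner ℝ a (M.grad w x))
          + 1 / 2 * surfSq M.boundary (fun x => √|M.normalComp a x| * w x)
          + 1 / 4 * κ * gradSq M w
          + 1 / 4 * β * κ * surfSq ΓD w) ∧
    ((a ≠ 0 ∨ (0 < β ∧ surface d ΓD ≠ 0)) →
      ∀ f gN φD : Space d → ℝ,
        MemLp f 2 (volume.restrict M.domain) →
        MemLp gN 2 ((surface d).restrict (M.boundary \ ΓD)) →
        MemLp φD 2 ((surface d).restrict ΓD) →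
        ∃! φ : Space d → ℝ, φ ∈ W ∧
          ∀ w ∈ W, B M ΓD a κ β τ γ w φ = rhs M ΓD a κ β τ γ f gN φD w) := by
  obtain ⟨hT₁, hT₂, hβ'⟩ := penalty_toReal hcs hβ
  have hτpos : 0 < τ := hτ ▸ tauEff_pos P τ₁a hτ₁d
  have hγ' : γ ^ 2 ≤ 3 * cs ^ 2 * κ * τ := by
    rw [hτ, hγ]; exact gammaEff_sq_le P cs hκ τ₁a hτ₁d
  have hcoer : ∀ w ∈ W, _ ≤ B M ΓD a κ β τ γ w w := fun w hw =>
    coercive hd hW hΓD a hκ hτpos hγ' hT₁ hT₂ hβ' hw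
      (laplacian_le_of_tauBound hκ (hτ ▸ tauEff_le P τ₁a hτ₁d) hbound hw)
  refine ⟨hcoer, fun hdata f gN φD hf hgN hφD => existsUnique_of_definite hW.finiteDimensional
    (isBilin_B hd hW hΓD a κ β τ γ) (isLin_rhs hd hW hΓD a κ β τ γ hf hgN hφD) fun w hw h0 => ?_⟩
  have hw0 := hcoer w hw
  rw [h0] at hw0
  -- The penalty condition makes `β` non-negative, so all four terms of the lower bound are
  -- non-negative and vanish separately when the energy is zero.
  have hβ0 : 0 ≤ β := le_trans (by positivity) hβ'
  have hA := mul_nonneg hτpos.le (volSq_nonneg M.domain fun x => inner ℝ a (M.grad w x))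
  have hN := surfSq_nonneg M.boundary fun x => √|M.normalComp a x| * w x
  have hG := mul_nonneg hκ.le (gradSq_nonneg M w)
  have hS := mul_nonneg (mul_nonneg hβ0 hκ.le) (surfSq_nonneg ΓD w)
  have hG0 : gradSq M w = 0 :=
    (mul_eq_zero.1 (show κ * gradSq M w = 0 by linarith)).resolve_left hκ.ne'
  refine eq_zero_of_norms_eq_zero hd hW hΓD hΓDm (a := a) hw hG0 ?_
  rcases hdata with ha | ⟨hβpos, hΓ⟩
  · exact Or.inl ⟨ha, by linarith⟩
  · exact Or.inr ⟨hΓ, (mul_eq_zero.1 (show β * κ * surfSq ΓD w = 0 by linarith)).resolve_left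
      (mul_pos hβpos hκ).ne'⟩
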